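/- Let $\langle t\rangle=\{0,1,t,t^2,\dots\}$, $\langle t^{-1}\rangle=\{0,1,t^{-1},t^{-2},\dots\}$ and $\langle t,t^{-1}\rangle=\{0\}\cup\{t^k: k\in\mathbb Z\}$, as commutative monoids with zero. The monoid projective line $\mathbb P^1$ is obtained by gluing $U_0=\operatorname{Spec}\langle t\rangle$ and $U_\infty=\operatorname{Spec}\langle t^{-1}\rangle$ along $U_0\cap U_\infty=\operatorname{Spec}\langle t,t^{-1}\rangle$. It has two closed points $0\in U_0$ and $\infty\in U_\infty$ and one generic point $\eta$, its nonempty open sets are those containing $\eta$, and its structure sheaf $\mathcal O$ has sections $\langle t\rangle,\langle t^{-1}\rangle,\langle t,t^{-1}\rangle$ over $U_0,U_\infty,U_0\cap U_\infty$, which are its nonempty affine open sets. For a commutative monoid with zero $A$, an $A$-module is a pointed set $(M,*)$ with an action of $A$ such that $0\cdot m=*$ for all $m$. It is normal if for every $a\in A$ the map $m\mapsto a\cdot m$ is injective on the set of $m$ with $a\cdot m\ne *$. A morphism of $A$-modules $f:M\to N$ is an equivariant map preserving base points, and it is normal if it is injective on $M\setminus f^{-1}(*)$. A sheaf of $\mathcal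 O$-modules on $\mathbb P^1$ is coherent if its restriction to each affine open $U$ is the sheaf $\widetilde M$ associated with a finitely generated $\mathcal O(U)$-module $M$; such a sheaf, or a morphism of such sheaves, is normal if its modules of sections, or its maps on sections, over all affine open sets are normal. Let $\mathrm{Coh}_n(\mathbb P^1)$ be the category of normal coherent sheaves and normal morphisms. The direct sum $\mathcal F\oplus\mathcal G$ is the sheaf given on affine open sets by the wedge sum $\mathcal F(U)\vee\mathcal G(U)$ of pointed sets; direct sums of sequences are formed termwise. A sequence $\emptyset\to\mathcal F\to\mathcal F'\to\mathcal F''\to\emptyset$ in $\mathrm{Coh}_n(\mathbb P^1)$, where $\emptyset$ is the zero sheaf, is short exact if on every affine open set the first map is injective, the second is surjective, and the image of the first is the preimage of the base point under the second. It is split if it is isomorphic to a sequence $\emptyset\to\mathcal F\to\mathcal F\oplus\mathcal G\to\mathcal G\to\emptyset$ formed by the canonical inclusion and projection. For $n\in\mathbb Z$, $\mathcal O(n)$ is the line bundle obtained by gluing $\langle t\rangle$ on $U_0$ and $\langle t^{-1}\rangle$ on $U_\infty$ by the clutching isomorphism $t^k\mapsto t^{k-n}$, $0\mapsto 0$, of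 $\langle t,t^{-1}\rangle$. For an integer $n\ge 0$, $\mathcal T_{0,n}$ is the skyscraper sheaf at $0$ with stalk the quotient module $\langle t\rangle/\{0,t^n,t^{n+1},\dots\}$, and $\mathcal T_{\infty,n}$ is the skyscraper sheaf at $\infty$ with stalk $\langle t^{-1}\rangle/\{0,t^{-n},t^{-n-1},\dots\}$. **Theorem.** Every short exact sequence in $\mathrm{Coh}_n(\mathbb P^1)$ is isomorphic to a finite direct sum of short exact sequences in $\mathrm{Coh}_n(\mathbb P^1)$, each of which has one of the following forms (up to isomorphism of its terms): 1. $\emptyset\to\mathcal T_{x,m}\to\mathcal T_{x,n}\to\mathcal T_{x,n-m}\to\emptyset$ with $x\in\{0,\infty\}$ and integers $0\le m\le n$; 2. $\emptyset\to\mathcal O(n)\to\mathcal O(m)\to\mathcal T_{0,k_0}\oplus\mathcal T_{\infty,k_\infty}\to\emptyset$ with $n,m\in\mathbb Z$ and integers $k_0,k_\infty\ge 0$ such that $k_0+k_\infty=m-n$; 3. a split short exact sequence. -/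

import Mathlib

open TopologicalSpace

universe u v w

namespace FunP1

section Modules

/-- A module over a monoid with zero `A` is a pointed set with an action of `A` for which `0` acts
as the constant map to the base point (Mathlib's `MulActionWithZero A M`, the base point being
`0 : M`). It is normal if multiplication by every `a : A` is injective away from the preimage of the
base point. -/
def IsNormalModule (A : Type u) (M : Type v) [MonoidWithZero A] [Zero M] [MulActionWithZero A M] :
    Prop :=
  ∀ (a : A) (m m' : M), a • m ≠ 0 → a • m = a • m' → m = m'

/-- Finite generation: every element is a multiple of one of finitely many generators. -/
def IsFGModule (A : Type u) (M : Type v) [MonoidWithZero A] [Zero M] [MulActionWithZero A M] :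
    Prop :=
  ∃ G : Finset M, ∀ m : M, ∃ g ∈ G, ∃ a : A, m = a • g

/-- The quotient `M / N` of a module by a submodule: the elements of `N` are collapsed to the base
point. Its elements are the base point and the elements of `M` outside `N`. -/
def ModQuot {A : Type u} {M : Type v} [MonoidWithZero A] [Zero M] [MulActionWithZero A M]
    (N : SubMulAction A M) : Type v :=
  {m : M // m ∈ N → m = 0}

namespace ModQuot

variable {A : Type u} {M : Type v} [MonoidWithZero A] [Zero M] [MulActionWithZero A M]
  (N : SubMulAction A M)

instance : Zero (ModQuot N) := ⟨⟨0, fun _ => rfl⟩⟩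

open Classical in
/-- The class of an element of `M` in `M / N`. -/
noncomputable def mk (m : M) : ModQuot N :=
  if h : m ∈ N then 0 else ⟨m, fun h' => absurd h' h⟩

theorem mk_of_mem {m : M} (h : m ∈ N) : mk N m = 0 := by simp [mk, h]

theorem mk_val (m : ModQuot N) : mk N m.1 = m := by
  by_cases h : m.1 ∈ N
  · rw [mk_of_mem N h]
    exact Subtype.ext (m.2 h).symm
  · exact dif_neg h

theorem mk_val_of_notMem {m : M} (h : m ∉ N) : (mk N m).1 = m :=
  congrArg Subtype.val (dif_neg h)

theorem mk_zero : mk N (0 : M) = 0 := mk_val N 0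

theorem mk_smul_val_mk (a : A) (m : M) : mk N (a • (mk N m).1) = mk N (a • m) := by
  by_cases h : m ∈ N
  · rw [mk_of_mem N h, mk_of_mem N (N.smul_mem a h)]
    change mk N (a • (0 : M)) = 0
    rw [smul_zero, mk_zero]
  · rw [mk_val_of_notMem N h]

noncomputable instance : MulActionWithZero A (ModQuot N) where
  smul a m := mk N (a • m.1)
  one_smul m := by
    change mk N ((1 : A) • m.1) = m
    rw [one_smul, mk_val]
  mul_smul a b m := by
    change mk N ((a * b) • m.1) = mk N (a • (mk N (b • m.1)).1)
    rw [mk_smul_val_mk, mul_smul]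
  smul_zero a := by
    change mk N (a • (0 : M)) = 0
    rw [smul_zero, mk_zero]
  zero_smul m := by
    change mk N ((0 : A) • m.1) = 0
    rw [zero_smul, mk_zero]

end ModQuot

end Modules

section Space

/-- The points of the projective line over the field with one element: the closed points `0`, `∞`
and the generic point. -/
inductive P1 : Type
  | zero : P1
  | infty : P1
  | eta : P1

/-- The open sets are the empty set and the sets containing the generic point: this is the gluing
of the two-point spaces `U₀ = {0, η}` and `U_∞ = {∞, η}` along the open point `{η}`. -/
instance : TopologicalSpace P1 where
  IsOpen U := U.Nonempty → P1.eta ∈ U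
  isOpen_univ := fun _ => Set.mem_univ _
  isOpen_inter := fun _ _ hU hV h =>
    ⟨hU (h.mono Set.inter_subset_left), hV (h.mono Set.inter_subset_right)⟩
  isOpen_sUnion := fun _ hs h => by
    obtain ⟨x, U, hU, hx⟩ := h
    exact ⟨U, hU, hs U hU ⟨x, hx⟩⟩

/-- The smallest open neighbourhood `{x, η}` of `x`. For `x = 0, ∞, η` these are the affine open
sets `U₀`, `U_∞`, `U₀ ∩ U_∞`, which are all the nonempty affine open sets. The stalk of a sheaf at
`x` is its set of sections over `nbhd x`. -/
def nbhd (x : P1) : Opens P1 := ⟨{x, P1.eta}, fun _ => by simp⟩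

theorem mem_nbhd (x : P1) : x ∈ nbhd x := Set.mem_insert _ _

theorem eta_mem_nbhd (x : P1) : P1.eta ∈ nbhd x := Set.mem_insert_of_mem _ rfl

theorem eta_mem {U : Opens P1} {x : P1} (h : x ∈ U) : P1.eta ∈ U := U.isOpen ⟨x, h⟩

theorem nbhd_le {U : Opens P1} {x : P1} (h : x ∈ U) : nbhd x ≤ U := by
  intro y hy
  rcases hy with rfl | rfl
  · exact h
  · exact eta_mem h

theorem nbhd_eta_le (x : P1) : nbhd P1.eta ≤ nbhd x := nbhd_le (eta_mem_nbhd x)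

/-- The monoid `⟨t, t⁻¹⟩ = {0} ∪ {tᵏ | k ∈ ℤ}`. -/
abbrev K : Type := WithZero (Multiplicative ℤ)

/-- The generator `t` of `⟨t, t⁻¹⟩`. -/
def t : K := ((Multiplicative.ofAdd (1 : ℤ) : Multiplicative ℤ) : K)

/-- The submonoid `{0, 1, a, a², …}`. -/
def zeroPowers (a : K) : Submonoid K where
  carrier := {b | b = 0 ∨ ∃ k : ℕ, b = a ^ k}
  one_mem' := Or.inr ⟨0, (pow_zero a).symm⟩
  mul_mem' := by
    rintro b c (rfl | ⟨k, rfl⟩) (rfl | ⟨l, rfl⟩)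
    · exact Or.inl (zero_mul _)
    · exact Or.inl (zero_mul _)
    · exact Or.inl (mul_zero _)
    · exact Or.inr ⟨k + l, (pow_add a k l).symm⟩

/-- The stalks of the structure sheaf: `⟨t⟩` at `0`, `⟨t⁻¹⟩` at `∞`, and `⟨t, t⁻¹⟩` at the generic
point. -/
def stalk : P1 → Submonoid K
  | P1.zero => zeroPowers t
  | P1.infty => zeroPowers t⁻¹
  | P1.eta => ⊤

theorem zero_mem_stalk (x : P1) : (0 : K) ∈ stalk x := by
  cases x
  · exact Or.inl rfl
  · exact Or.inl rfl
  · exact Submonoid.mem_top _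

instance (x : P1) : CommMonoidWithZero (stalk x) :=
  { (inferInstance : CommMonoid (stalk x)) with
    zero := ⟨0, zero_mem_stalk x⟩
    zero_mul := fun _ => Subtype.ext (zero_mul _)
    mul_zero := fun _ => Subtype.ext (mul_zero _) }

/-- Sections of the structure sheaf over `U`: families of germs, compatible with restriction. As all
stalks lie in the generic one, these are the constant functions `U → ⟨t, t⁻¹⟩` with value at every
`x ∈ U` in the stalk at `x`; there is exactly one such function on the empty set. So the sections
over `U₀`, `U_∞`, `U₀ ∩ U_∞` are `⟨t⟩`, `⟨t⁻¹⟩`, `⟨t, t⁻¹⟩`. -/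
def O (U : Opens P1) : Submonoid (U → K) where
  carrier := {s | (∀ x : U, s x ∈ stalk x) ∧ ∀ x y : U, s x = s y}
  one_mem' := ⟨fun _ => one_mem _, fun _ _ => rfl⟩
  mul_mem' := fun ha hb =>
    ⟨fun x => mul_mem (ha.1 x) (hb.1 x), fun x y => congrArg₂ (· * ·) (ha.2 x y) (hb.2 x y)⟩

instance (U : Opens P1) : CommMonoidWithZero (O U) :=
  { (inferInstance : CommMonoid (O U)) with
    zero := ⟨0, fun x => zero_mem_stalk x, fun _ _ => rfl⟩
    zero_mul := fun _ => Subtype.ext (zero_mul _)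
    mul_zero := fun _ => Subtype.ext (mul_zero _) }

/-- Restriction of sections of the structure sheaf. -/
def O.res {U V : Opens P1} (h : V ≤ U) (a : O U) : O V :=
  ⟨fun x => a.1 ⟨x.1, h x.2⟩, fun x => a.2.1 ⟨x.1, h x.2⟩, fun _ _ => a.2.2 _ _⟩

/-- The germ at `x ∈ U` of a section of the structure sheaf over `U`. -/
def O.germ {U : Opens P1} {x : P1} (h : x ∈ U) (a : O U) : stalk x :=
  ⟨a.1 ⟨x, h⟩, a.2.1 ⟨x, h⟩⟩

end Space

section Sheaves

/-- Sheaves of modules over the structure sheaf of the projective line. -/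
structure OMod : Type (u + 1) where
  sec : Opens P1 → Type u
  [instZero : ∀ U, Zero (sec U)]
  [instAct : ∀ U, MulActionWithZero (O U) (sec U)]
  res : ∀ {U V : Opens P1}, V ≤ U → sec U → sec V
  res_zero : ∀ {U V : Opens P1} (h : V ≤ U), res h 0 = 0
  res_smul : ∀ {U V : Opens P1} (h : V ≤ U) (a : O U) (s : sec U),
    res h (a • s) = O.res h a • res h s
  res_self : ∀ {U : Opens P1} (s : sec U), res le_rfl s = s
  res_res : ∀ {U V W : Opens P1} (h : V ≤ U) (h' : W ≤ V) (s : sec U),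
    res h' (res h s) = res (h'.trans h) s
  glue : ∀ {ι : Type} (U : ι → Opens P1) (s : ∀ i, sec (U i)),
    (∀ i j, res (inf_le_left : U i ⊓ U j ≤ U i) (s i) =
      res (inf_le_right : U i ⊓ U j ≤ U j) (s j)) →
    ∃! r : sec (⨆ i, U i), ∀ i, res (le_iSup U i) r = s i

attribute [instance] OMod.instZero OMod.instAct

namespace OMod

/-- Morphisms of sheaves of modules. -/
structure Hom (F : OMod.{u}) (G : OMod.{v}) where
  app : ∀ U : Opens P1, F.sec U → G.sec U
  map_zero : ∀ U, app U 0 = 0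
  map_smul : ∀ (U) (a : O U) (s : F.sec U), app U (a • s) = a • app U s
  map_res : ∀ {U V : Opens P1} (h : V ≤ U) (s : F.sec U), app V (F.res h s) = G.res h (app U s)

/-- A morphism is an isomorphism if it is bijective on sections over every open set. -/
def Hom.IsIso {F : OMod.{u}} {G : OMod.{v}} (f : Hom F G) : Prop :=
  ∀ U, Function.Bijective (f.app U)

/-- `F ≃ G`. -/
def Isomorphic (F : OMod.{u}) (G : OMod.{v}) : Prop := ∃ f : Hom F G, f.IsIso

/-- A morphism is normal if on every affine open set it is injective away from the preimage of the
base point. -/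
def Hom.IsNormal {F : OMod.{u}} {G : OMod.{v}} (f : Hom F G) : Prop :=
  ∀ (x : P1) (s s' : F.sec (nbhd x)),
    f.app (nbhd x) s ≠ 0 → f.app (nbhd x) s = f.app (nbhd x) s' → s = s'

/-- A sheaf of modules is coherent if its restriction to every affine open set `nbhd x` is the sheaf
associated with a finitely generated module. As the only nonempty open subsets of `nbhd x` are
`nbhd x` and `nbhd η`, this says that the sections over `nbhd x` are finitely generated, and that
the restriction to `nbhd η` is the localization at the multiplicative set of nonzero sections
of `O` over `nbhd x` (namely the powers of `t`, of `t⁻¹`, or all units, for `x = 0, ∞, η`): every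
section over `nbhd η` is a fraction `s / a`, and `s / 1 = s' / 1` only if `a s = a s'` for some `a`
in that set. -/
structure IsCoherent (F : OMod.{u}) : Prop where
  fg : ∀ x : P1, IsFGModule (O (nbhd x)) (F.sec (nbhd x))
  surj : ∀ (x : P1) (r : F.sec (nbhd P1.eta)), ∃ (a : O (nbhd x)) (s : F.sec (nbhd x)), a ≠ 0 ∧
    O.res (nbhd_eta_le x) a • r = F.res (nbhd_eta_le x) s
  eq : ∀ (x : P1) (s s' : F.sec (nbhd x)),
    F.res (nbhd_eta_le x) s = F.res (nbhd_eta_le x) s' → ∃ a : O (nbhd x), a ≠ 0 ∧ a • s = a • s'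

/-- A sheaf of modules is normal if its sections over every affine open set form a normal module. -/
def IsNormal (F : OMod.{u}) : Prop :=
  ∀ x : P1, IsNormalModule (O (nbhd x)) (F.sec (nbhd x))

/-- The objects of `Coh_n(ℙ¹)`. -/
def IsCohN (F : OMod.{u}) : Prop := F.IsCoherent ∧ F.IsNormal

/-- Sections over `U` of the direct sum of sheaves of modules, which is the sheaf associated with
`U ↦ ⋁ᵢ Fᵢ(U)`. The wedge sum of pointed sets is the set of elements of the product with at most one
coordinate different from the base point, so a section of the direct sum over `U` is an element of
`∏ᵢ Fᵢ(U)` which has this property in the stalk at every point of `U`. -/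
def SumSec {ι : Type w} (F : ι → OMod.{u}) (U : Opens P1) : Type (max u w) :=
  {f : ∀ i, (F i).sec U // ∀ (x : P1) (hx : x ∈ U) (i j : ι),
    (F i).res (nbhd_le hx) (f i) ≠ 0 → (F j).res (nbhd_le hx) (f j) ≠ 0 → i = j}

instance {ι : Type w} (F : ι → OMod.{u}) (U : Opens P1) : Zero (SumSec F U) :=
  ⟨⟨fun _ => 0, fun _ hx i _ h => absurd ((F i).res_zero (nbhd_le hx)) h⟩⟩

instance {ι : Type w} (F : ι → OMod.{u}) (U : Opens P1) :
    MulActionWithZero (O U) (SumSec F U) where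
  smul a f := ⟨fun i => a • f.1 i, fun x hx i j hi hj => by
    refine f.2 x hx i j (fun h => hi ?_) (fun h => hj ?_)
    · rw [res_smul, h, smul_zero]
    · rw [res_smul, h, smul_zero]⟩
  one_smul _ := Subtype.ext (funext fun _ => one_smul _ _)
  mul_smul _ _ _ := Subtype.ext (funext fun _ => mul_smul _ _ _)
  smul_zero _ := Subtype.ext (funext fun _ => smul_zero _)
  zero_smul _ := Subtype.ext (funext fun _ => zero_smul _ _)

/-- The direct sum of sheaves of modules. -/
def directSum {ι : Type w} (F : ι → OMod.{u}) : OMod.{max u w} where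
  sec U := SumSec F U
  res h f := ⟨fun i => (F i).res h (f.1 i), fun x hx i j hi hj => by
    rw [res_res] at hi hj
    exact f.2 x (h hx) i j hi hj⟩
  res_zero h := Subtype.ext (funext fun i => (F i).res_zero h)
  res_smul h a f := Subtype.ext (funext fun i => (F i).res_smul h a (f.1 i))
  res_self f := Subtype.ext (funext fun i => (F i).res_self (f.1 i))
  res_res h h' f := Subtype.ext (funext fun i => (F i).res_res h h' (f.1 i))
  glue U s hs := by
    have key := fun i => (F i).glue U (fun k => (s k).1 i)
      (fun k l => congrFun (congrArg Subtype.val (hs k l)) i)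
    choose r hr hr' using key
    refine ⟨⟨r, fun x hx i j hi hj => ?_⟩, fun k => Subtype.ext (funext fun i => hr i k), ?_⟩
    · obtain ⟨k, hk⟩ := Opens.mem_iSup.1 hx
      have e : ∀ i, (F i).res (nbhd_le hx) (r i) = (F i).res (nbhd_le hk) ((s k).1 i) := by
        intro i
        rw [← hr i k, res_res]
      rw [e] at hi hj
      exact (s k).2 x hk i j hi hj
    · intro r' h'
      exact Subtype.ext (funext fun i =>
        hr' i (r'.1 i) fun k => congrFun (congrArg Subtype.val (h' k)) i)

/-- The direct sum of a family of morphisms. -/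
def Hom.directSum {ι : Type w} {F : ι → OMod.{u}} {G : ι → OMod.{v}} (f : ∀ i, Hom (F i) (G i)) :
    Hom (OMod.directSum F) (OMod.directSum G) where
  app U s := ⟨fun i => (f i).app U (s.1 i), fun x hx i j hi hj => by
    refine s.2 x hx i j (fun h => hi ?_) (fun h => hj ?_)
    · rw [← (f i).map_res, h, (f i).map_zero]
    · rw [← (f j).map_res, h, (f j).map_zero]⟩
  map_zero U := Subtype.ext (funext fun i => (f i).map_zero U)
  map_smul U a s := Subtype.ext (funext fun i => (f i).map_smul U a (s.1 i))
  map_res h s := Subtype.ext (funext fun i => (f i).map_res h (s.1 i))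

/-- The direct sum `F ⊕ G` of two sheaves. -/
def oplus (F G : OMod.{u}) : OMod.{u} := directSum (fun b : Bool => bif b then G else F)

/-- The inclusion `F → F ⊕ G`. -/
def inl (F G : OMod.{u}) : Hom F (oplus F G) where
  app U s := ⟨fun b => match b with
    | false => s
    | true => (0 : G.sec U), fun x hx i j hi hj => by
      cases i <;> cases j
      · rfl
      · exact absurd (G.res_zero _) hj
      · exact absurd (G.res_zero _) hi
      · rfl⟩
  map_zero U := Subtype.ext (funext fun b => by cases b <;> rfl)
  map_smul U a s := Subtype.ext (funext fun b => by
    cases b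
    · rfl
    · exact (smul_zero a).symm)
  map_res h s := Subtype.ext (funext fun b => by
    cases b
    · rfl
    · exact (G.res_zero h).symm)

/-- The projection `F ⊕ G → G`. -/
def snd (F G : OMod.{u}) : Hom (oplus F G) G where
  app _ s := s.1 true
  map_zero _ := rfl
  map_smul _ _ _ := rfl
  map_res _ _ := rfl

/-- The stalks of the line bundle `O(n)` inside `⟨t, t⁻¹⟩`: `⟨t⟩` at `0`, `tⁿ⟨t⁻¹⟩` at `∞`, and
`⟨t, t⁻¹⟩` at the generic point. -/
def lineStalk (n : ℤ) : P1 → Set K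
  | P1.zero => {a | a ∈ stalk P1.zero}
  | P1.infty => {a | ∃ b ∈ stalk P1.infty, a = t ^ n * b}
  | P1.eta => Set.univ

theorem zero_mem_lineStalk (n : ℤ) (x : P1) : (0 : K) ∈ lineStalk n x := by
  cases x
  · exact zero_mem_stalk P1.zero
  · exact ⟨0, zero_mem_stalk _, (mul_zero _).symm⟩
  · trivial

theorem mul_mem_lineStalk (n : ℤ) (x : P1) {a b : K} (ha : a ∈ stalk x) (hb : b ∈ lineStalk n x) :
    a * b ∈ lineStalk n x := by
  cases x
  · exact (stalk P1.zero).mul_mem ha hb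
  · obtain ⟨c, hc, rfl⟩ := hb
    exact ⟨a * c, (stalk P1.infty).mul_mem ha hc, mul_left_comm _ _ _⟩
  · trivial

/-- Sections of `O(n)` over `U`: the constant functions on `U` with values in the stalks. -/
def LineSec (n : ℤ) (U : Opens P1) : Type :=
  {s : U → K // (∀ x : U, s x ∈ lineStalk n x) ∧ ∀ x y : U, s x = s y}

instance (n : ℤ) (U : Opens P1) : Zero (LineSec n U) :=
  ⟨⟨fun _ => 0, fun x => zero_mem_lineStalk n x, fun _ _ => rfl⟩⟩

instance (n : ℤ) (U : Opens P1) : MulActionWithZero (O U) (LineSec n U) where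
  smul a s := ⟨fun x => a.1 x * s.1 x,
    fun x => mul_mem_lineStalk n x (a.2.1 x) (s.2.1 x),
    fun x y => congrArg₂ (· * ·) (a.2.2 x y) (s.2.2 x y)⟩
  one_smul _ := Subtype.ext (funext fun _ => one_mul _)
  mul_smul _ _ _ := Subtype.ext (funext fun _ => mul_assoc _ _ _)
  smul_zero _ := Subtype.ext (funext fun _ => mul_zero _)
  zero_smul _ := Subtype.ext (funext fun _ => zero_mul _)

/-- The line bundle `O(n)`. In terms of the generator `1` over `U₀` and the generator `tⁿ` over
`U_∞`, its clutching map sends `tᵏ` to `tᵏ⁻ⁿ`. Its nonzero global sections are `1, t, …, tⁿ`. -/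
def lineBundle (n : ℤ) : OMod.{0} where
  sec U := LineSec n U
  res h s := ⟨fun x => s.1 ⟨x.1, h x.2⟩, fun x => s.2.1 ⟨x.1, h x.2⟩, fun _ _ => s.2.2 _ _⟩
  res_zero _ := rfl
  res_smul _ _ _ := rfl
  res_self _ := rfl
  res_res _ _ _ := rfl
  glue U s hs := by
    have hU : ∀ x : ↥(⨆ i, U i), ∃ i, x.1 ∈ U i := fun x => Opens.mem_iSup.1 x.2
    choose c hc using hU
    have agree : ∀ i j (x : P1) (hi : x ∈ U i) (hj : x ∈ U j),
        (s i).1 ⟨x, hi⟩ = (s j).1 ⟨x, hj⟩ := fun i j x hi hj =>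
      congrFun (congrArg Subtype.val (hs i j)) ⟨x, ⟨hi, hj⟩⟩
    refine ⟨⟨fun x => (s (c x)).1 ⟨x.1, hc x⟩, fun x => (s (c x)).2.1 ⟨x.1, hc x⟩, fun x y => ?_⟩,
      fun i => Subtype.ext (funext fun x => agree _ _ _ _ _), fun r hr => ?_⟩
    · change (s (c x)).1 ⟨x.1, hc x⟩ = (s (c y)).1 ⟨y.1, hc y⟩
      rw [(s (c x)).2.2 ⟨x.1, hc x⟩ ⟨P1.eta, eta_mem (hc x)⟩,
        (s (c y)).2.2 ⟨y.1, hc y⟩ ⟨P1.eta, eta_mem (hc y)⟩]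
      exact agree _ _ _ _ _
    · exact Subtype.ext (funext fun x =>
        congrFun (congrArg Subtype.val (hr (c x))) ⟨x.1, hc x⟩)

/-- The generator of the maximal ideal of the stalk at a closed point: `t` at `0` and `t⁻¹` at `∞`
(and the unit `1` at the generic point). -/
def unif : (x : P1) → stalk x
  | P1.zero => ⟨t, Or.inr ⟨1, (pow_one t).symm⟩⟩
  | P1.infty => ⟨t⁻¹, Or.inr ⟨1, (pow_one t⁻¹).symm⟩⟩
  | P1.eta => 1

/-- The submodule `Eₙ` of the stalk at `x` generated by the `n`-th power of `unif x`; at `x = 0`,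
it is `{0, tⁿ, tⁿ⁺¹, …}`. -/
def torsionSub (x : P1) (n : ℕ) : SubMulAction (stalk x) (stalk x) where
  carrier := {a | ∃ b : stalk x, a = unif x ^ n * b}
  smul_mem' := by
    rintro c _ ⟨b, rfl⟩
    exact ⟨c * b, mul_left_comm _ _ _⟩

/-- Sections over `U` of the skyscraper sheaf at `x` with stalk `⟨unif x⟩ / Eₙ`: the elements of
this quotient if `x ∈ U`, and just the base point if `x ∉ U`. -/
def TorsionSec (x : P1) (n : ℕ) (U : Opens P1) : Type :=
  x ∈ U → ModQuot (torsionSub x n)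

instance (x : P1) (n : ℕ) (U : Opens P1) : Zero (TorsionSec x n U) := ⟨fun _ => 0⟩

noncomputable instance (x : P1) (n : ℕ) (U : Opens P1) :
    MulActionWithZero (O U) (TorsionSec x n U) where
  smul a s := fun h => O.germ h a • s h
  one_smul s := funext fun h => one_smul (stalk x) (s h)
  mul_smul a b s := funext fun h => mul_smul (O.germ h a) (O.germ h b) (s h)
  smul_zero a := funext fun h => smul_zero (O.germ h a)
  zero_smul s := funext fun h => zero_smul (stalk x) (s h)

/-- The torsion sheaf `T_{x,n}`, for a closed point `x`: the skyscraper sheaf at `x` with stalk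
`Tₙ = ⟨unif x⟩ / Eₙ`. -/
noncomputable def torsion (x : P1) (n : ℕ) : OMod.{0} where
  sec U := TorsionSec x n U
  res h s := fun h' => s (h h')
  res_zero _ := rfl
  res_smul _ _ _ := rfl
  res_self _ := rfl
  res_res _ _ _ := rfl
  glue U s hs := by
    have hU : x ∈ (⨆ i, U i) → ∃ i, x ∈ U i := Opens.mem_iSup.1
    refine ⟨fun h => s (hU h).choose (hU h).choose_spec, fun i => funext fun h => ?_,
      fun r hr => funext fun h => ?_⟩
    · have hx := hU (Opens.mem_iSup.2 ⟨i, h⟩)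
      exact congrFun (hs hx.choose i) ⟨hx.choose_spec, h⟩
    · exact congrFun (hr (hU h).choose) (hU h).choose_spec

end OMod

end Sheaves

section Sequences

/-- Sequences `F → F' → F''` of sheaves of modules. -/
structure Seq : Type (u + 1) where
  F : OMod.{u}
  F' : OMod.{u}
  F'' : OMod.{u}
  i : OMod.Hom F F'
  p : OMod.Hom F' F''

namespace Seq

/-- Short exact sequences in `Coh_n(ℙ¹)`: the sheaves and the morphisms are normal, the sheaves are
coherent, and `∅ → F → F' → F'' → ∅` is exact on every affine open set. -/
structure IsShortExact (S : Seq.{u}) : Prop where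
  cohN : S.F.IsCohN
  cohN' : S.F'.IsCohN
  cohN'' : S.F''.IsCohN
  normal_i : S.i.IsNormal
  normal_p : S.p.IsNormal
  injective : ∀ x : P1, Function.Injective (S.i.app (nbhd x))
  exact : ∀ (x : P1) (s : S.F'.sec (nbhd x)),
    S.p.app (nbhd x) s = 0 ↔ ∃ r : S.F.sec (nbhd x), S.i.app (nbhd x) r = s
  surjective : ∀ x : P1, Function.Surjective (S.p.app (nbhd x))

/-- Isomorphism of sequences. -/
def Isomorphic (S : Seq.{u}) (S' : Seq.{v}) : Prop :=
  ∃ (f : OMod.Hom S.F S'.F) (f' : OMod.Hom S.F' S'.F') (f'' : OMod.Hom S.F'' S'.F''),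
    f.IsIso ∧ f'.IsIso ∧ f''.IsIso ∧
    (∀ U s, f'.app U (S.i.app U s) = S'.i.app U (f.app U s)) ∧
    (∀ U s, f''.app U (S.p.app U s) = S'.p.app U (f'.app U s))

/-- The direct sum of sequences. -/
def directSum {ι : Type w} (S : ι → Seq.{u}) : Seq.{max u w} where
  F := OMod.directSum fun k => (S k).F
  F' := OMod.directSum fun k => (S k).F'
  F'' := OMod.directSum fun k => (S k).F''
  i := OMod.Hom.directSum fun k => (S k).i
  p := OMod.Hom.directSum fun k => (S k).p

/-- The sequence `F → F ⊕ G → G`. -/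
def split (F G : OMod.{u}) : Seq.{u} where
  F := F
  F' := OMod.oplus F G
  F'' := G
  i := OMod.inl F G
  p := OMod.snd F G

/-- A sequence is split if it is isomorphic to one of the form `F → F ⊕ G → G`. -/
def IsSplit (S : Seq.{u}) : Prop := ∃ F G : OMod.{u}, S.Isomorphic (split F G)

/-- Sequences of the form `T_{x,m} → T_{x,n} → T_{x,n-m}` with `x ∈ {0, ∞}`. -/
def IsTorsionType (S : Seq.{u}) : Prop :=
  ∃ x : P1, x ≠ P1.eta ∧ ∃ m n : ℕ, m ≤ n ∧ S.F.Isomorphic (OMod.torsion x m) ∧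
    S.F'.Isomorphic (OMod.torsion x n) ∧ S.F''.Isomorphic (OMod.torsion x (n - m))

/-- Sequences of the form `O(n) → O(m) → T_{0,k₀} ⊕ T_{∞,k_∞}` with `k₀ + k_∞ = m - n`. -/
def IsLineType (S : Seq.{u}) : Prop :=
  ∃ (n m : ℤ) (k₀ k₁ : ℕ), (k₀ : ℤ) + (k₁ : ℤ) = m - n ∧ S.F.Isomorphic (OMod.lineBundle n) ∧
    S.F'.Isomorphic (OMod.lineBundle m) ∧
    S.F''.Isomorphic (OMod.oplus (OMod.torsion P1.zero k₀) (OMod.torsion P1.infty k₁))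

end Seq

end Sequences

end FunP1

namespace FunP1

/-! ### The structure sheaf on the sets `nbhd x` -/

/-! A sheaf on the projective line is the same as three stalks with the two restriction maps to the
generic one, so everything can be checked on stalks (`existsUnique_of_germs`, `exists_hom`).

Join two nonzero elements of the stalks of a sheaf when one is a multiple or a restriction of the
other. A labelling that is constant along these edges splits the sheaf as a direct sum
(`exists_hom_directSum_part`). In a short exact sequence, injectivity of the first map and normality
of the second make every nonzero element of the outer terms correspond to a unique element of the
middle term. A labelling of the middle term therefore splits the whole sequence
(`isomorphic_directSum_part`). Connected components give such a labelling, with finitely many labels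
by finite generation (`exists_labelling`). It remains to treat sequences whose middle term is
connected.

If the generic stalk of the middle term vanishes, a nonzero middle term lives at one closed point,
where its elements form a finite chain of successive multiples of one generator by the uniformizer.
Its submodules are the final segments of the chain, which gives the torsion type
(`isTorsionType_or_isSplit`).

If the generic stalk is nonzero, there is no torsion and the nonzero generic elements form one orbit
of the powers of `t`. When the subsheaf is zero or everything, the sequence splits. Otherwise the
orbit is free: were a positive power of the uniformizer to fix it, any stalk of the subsheaf would
contain the whole stalk of the middle term (`smul_injective`). In a free orbit each closed stalk is
a half-line of exponents, so the first two terms are line bundles, and the quotient consists of the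
finite gaps between the half-lines at the two closed points (`isLineType_or_isSplit`). -/

theorem mem_nbhd_iff {x y : P1} : y ∈ nbhd x ↔ y = x ∨ y = P1.eta := Iff.rfl

theorem le_nbhd_eta {W : Opens P1} {x y : P1} (hxy : x ≠ y) (hx : W ≤ nbhd x) (hy : W ≤ nbhd y) :
    W ≤ nbhd P1.eta := by
  intro z hz
  rcases mem_nbhd_iff.1 (hx hz) with rfl | rfl
  · rcases mem_nbhd_iff.1 (hy hz) with rfl | rfl
    · exact absurd rfl hxy
    · exact mem_nbhd _
  · exact mem_nbhd _

instance : Finite P1 :=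
  Finite.of_surjective (fun i : Fin 3 => ![P1.zero, P1.infty, P1.eta] i) fun x => by
    cases x
    exacts [⟨0, rfl⟩, ⟨1, rfl⟩, ⟨2, rfl⟩]

/-- The value of a section over `nbhd x`. -/
def value {x : P1} (a : O (nbhd x)) : K := a.1 ⟨x, mem_nbhd x⟩

namespace O

theorem val_injective {x : P1} : Function.Injective (value (x := x)) := fun a b h =>
  Subtype.ext (funext fun y => (a.2.2 y _).trans (h.trans (b.2.2 _ y)))

theorem val_mem {x : P1} (a : O (nbhd x)) : value a ∈ stalk x :=
  a.2.1 ⟨x, mem_nbhd x⟩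

@[simp] theorem val_zero {x : P1} : value (0 : O (nbhd x)) = 0 := rfl

@[simp] theorem val_pow {x : P1} (a : O (nbhd x)) (k : ℕ) : value (a ^ k) = value a ^ k := rfl

theorem val_eq_zero {x : P1} {a : O (nbhd x)} : value a = 0 ↔ a = 0 :=
  ⟨fun h => val_injective h, fun h => by rw [h, val_zero]⟩

@[simp] theorem val_res {x : P1} (a : O (nbhd x)) : value (O.res (nbhd_eta_le x) a) = value a :=
  a.2.2 _ _

/-- The section over `nbhd x` with a given value. -/
def ofVal (x : P1) (v : K) (hv : v ∈ stalk x) : O (nbhd x) :=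
  ⟨fun _ => v, fun y => by
    obtain ⟨y, rfl | rfl⟩ := y
    · exact hv
    · exact Submonoid.mem_top v, fun _ _ => rfl⟩

theorem mul_left_cancel {x : P1} {a b c : O (nbhd x)} (ha : a ≠ 0) (h : a * b = a * c) :
    b = c :=
  val_injective (mul_left_cancel₀ (fun h' => ha (val_eq_zero.1 h'))
    (congrArg value h : value a * value b = value a * value c))

/-- All elements of `⟨t, t⁻¹⟩` are sections over `nbhd η`. -/
def ofK : K →*₀ O (nbhd P1.eta) where
  toFun v := ofVal P1.eta v (Submonoid.mem_top v)
  map_zero' := rfl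
  map_one' := rfl
  map_mul' _ _ := rfl

/-- The generator of the maximal ideal as a section over `nbhd x`. -/
def unif (x : P1) : O (nbhd x) := ofVal x (OMod.unif x).1 (OMod.unif x).2

theorem unif_eta : unif P1.eta = 1 := rfl

end O

/-- The uniformizer at `x` as an element of `⟨t, t⁻¹⟩`. -/
def unifK (x : P1) : K := (OMod.unif x).1

theorem O.val_unif (x : P1) : value (O.unif x) = unifK x := rfl

theorem t_ne_zero : t ≠ 0 := WithZero.coe_ne_zero

theorem unifK_ne_zero (x : P1) : unifK x ≠ 0 := by
  cases x
  exacts [t_ne_zero, inv_ne_zero t_ne_zero, one_ne_zero]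

theorem t_zpow (k : ℤ) : t ^ k = ((Multiplicative.ofAdd k : Multiplicative ℤ) : K) := by
  rw [t, ← WithZero.coe_zpow, ← ofAdd_zsmul, smul_eq_mul, mul_one]

theorem exists_t_zpow {v : K} (hv : v ≠ 0) : ∃ k : ℤ, v = t ^ k := by
  obtain ⟨m, rfl⟩ := WithZero.ne_zero_iff_exists.1 hv
  exact ⟨m.toAdd, (t_zpow _).symm⟩

theorem t_zpow_injective {k l : ℤ} (h : t ^ k = t ^ l) : k = l := by
  rw [t_zpow, t_zpow] at h
  exact Multiplicative.ofAdd.injective (WithZero.coe_injective h)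

theorem exists_unifK_zpow {x : P1} (hx : x ≠ P1.eta) {v : K} (hv : v ≠ 0) :
    ∃ k : ℤ, v = unifK x ^ k := by
  obtain ⟨k, rfl⟩ := exists_t_zpow hv
  cases x
  · exact ⟨k, rfl⟩
  · exact ⟨-k, by change t ^ k = t⁻¹ ^ (-k); rw [inv_zpow', neg_neg]⟩
  · exact absurd rfl hx

theorem unifK_zpow_injective {x : P1} (hx : x ≠ P1.eta) {k l : ℤ}
    (h : unifK x ^ k = unifK x ^ l) : k = l := by
  cases x
  · exact t_zpow_injective h
  · change t⁻¹ ^ k = t⁻¹ ^ l at h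
    rw [inv_zpow', inv_zpow'] at h
    exact neg_injective (t_zpow_injective h)
  · exact absurd rfl hx

theorem mem_stalk_iff {x : P1} (hx : x ≠ P1.eta) {v : K} :
    v ∈ stalk x ↔ v = 0 ∨ ∃ k : ℕ, v = unifK x ^ k := by
  cases x
  exacts [Iff.rfl, Iff.rfl, absurd rfl hx]

theorem unifK_zpow_mem_stalk {x : P1} (hx : x ≠ P1.eta) {k : ℤ} :
    unifK x ^ k ∈ stalk x ↔ 0 ≤ k := by
  rw [mem_stalk_iff hx]
  constructor
  · rintro (h | ⟨l, h⟩)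
    · exact absurd h (zpow_ne_zero _ (unifK_ne_zero x))
    · rw [← zpow_natCast] at h
      rw [unifK_zpow_injective hx h]
      exact Int.natCast_nonneg l
  · intro h
    lift k to ℕ using h
    exact Or.inr ⟨k, zpow_natCast _ _⟩

theorem O.eq_zero_or_eq_pow {x : P1} (hx : x ≠ P1.eta) (a : O (nbhd x)) :
    a = 0 ∨ ∃ k : ℕ, a = O.unif x ^ k := by
  rcases (mem_stalk_iff hx).1 (O.val_mem a) with h | ⟨k, h⟩
  · exact Or.inl (O.val_eq_zero.1 h)
  · exact Or.inr ⟨k, O.val_injective h⟩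

theorem O.unif_pow_ne_zero (x : P1) (k : ℕ) : O.unif x ^ k ≠ 0 := fun h =>
  pow_ne_zero k (unifK_ne_zero x) (O.val_eq_zero.2 h)

theorem O.unif_pow_dvd_iff {x : P1} (hx : x ≠ P1.eta) {k l : ℕ} :
    O.unif x ^ k ∣ O.unif x ^ l ↔ k ≤ l := by
  refine ⟨?_, pow_dvd_pow _⟩
  rintro ⟨b, hb⟩
  rcases O.eq_zero_or_eq_pow hx b with rfl | ⟨j, rfl⟩
  · rw [mul_zero] at hb
    exact absurd hb (O.unif_pow_ne_zero x l)
  · have h := congrArg value hb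
    rw [← pow_add, O.val_pow, O.val_pow, O.val_unif, ← zpow_natCast, ← zpow_natCast] at h
    have := unifK_zpow_injective hx h
    omega

/-! ### Sections and morphisms on stalks -/

namespace OMod

/-- All elements of `K` act on the generic stalk, so scalars coming from different points can be
compared and inverted there. -/
instance (F : OMod.{u}) : MulActionWithZero K (F.sec (nbhd P1.eta)) :=
  MulActionWithZero.compHom _ O.ofK

theorem smul_eta (F : OMod.{u}) (a : O (nbhd P1.eta)) (r : F.sec (nbhd P1.eta)) :
    a • r = value a • r :=
  congrArg (· • r) (O.val_injective rfl : a = O.ofK (value a))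

/-- Restriction to the generic stalk. -/
def gen (F : OMod.{u}) {x : P1} (s : F.sec (nbhd x)) : F.sec (nbhd P1.eta) :=
  F.res (nbhd_eta_le x) s

@[simp] theorem gen_zero (F : OMod.{u}) {x : P1} : F.gen (0 : F.sec (nbhd x)) = 0 := F.res_zero _

@[simp] theorem gen_eta (F : OMod.{u}) (r : F.sec (nbhd P1.eta)) : F.gen r = r := F.res_self r

theorem gen_smul (F : OMod.{u}) {x : P1} (a : O (nbhd x)) (s : F.sec (nbhd x)) :
    F.gen (a • s) = value a • F.gen s := by
  rw [gen, F.res_smul, smul_eta, O.val_res, gen]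

theorem Hom.map_gen {F : OMod.{u}} {G : OMod.{v}} (f : Hom F G) {x : P1} (s : F.sec (nbhd x)) :
    f.app _ (F.gen s) = G.gen (f.app _ s) := f.map_res _ s

theorem Hom.map_smulK {F : OMod.{u}} {G : OMod.{v}} (f : Hom F G) (a : K)
    (s : F.sec (nbhd P1.eta)) : f.app _ (a • s) = a • f.app _ s := f.map_smul _ _ s

theorem smulK_ne_zero (F : OMod.{u}) {v : K} (hv : v ≠ 0) {r : F.sec (nbhd P1.eta)} (hr : r ≠ 0) :
    v • r ≠ 0 := fun h => hr (by rw [← inv_smul_smul₀ hv r, h, smul_zero])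

/-- An open set is covered by the sets `nbhd x` of its points, and two different such sets meet
inside `nbhd η`. Compatibility on overlaps is thus agreement in the generic stalk. -/
theorem existsUnique_of_germs (F : OMod.{u}) (U : Opens P1) (s : ∀ x ∈ U, F.sec (nbhd x))
    (hs : ∀ x (hx : x ∈ U), F.gen (s x hx) = s P1.eta (eta_mem hx)) :
    ∃! r : F.sec U, ∀ x (hx : x ∈ U), F.res (nbhd_le hx) r = s x hx := by
  have hU : U = ⨆ i : {x // x ∈ U}, nbhd i.1 := by
    refine le_antisymm (fun x hx => Opens.mem_iSup.2 ⟨⟨x, hx⟩, mem_nbhd x⟩)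
      (iSup_le fun i => nbhd_le i.2)
  -- `U` also indexes the cover, so the union is identified with a separate variable `V` instead of
  -- rewriting `U`.
  have key : ∀ V : Opens P1, V = ⨆ i : {x // x ∈ U}, nbhd i.1 →
      ∃! r : F.sec V, ∀ (i : {x // x ∈ U}) (h : nbhd i.1 ≤ V), F.res h r = s i.1 i.2 := by
    rintro _ rfl
    have := F.glue (fun i : {x // x ∈ U} => nbhd i.1) (fun i => s i.1 i.2) (by
      rintro ⟨x, hx⟩ ⟨y, hy⟩
      by_cases hxy : x = y
      · subst hxy; rfl
      · have hW : nbhd x ⊓ nbhd y ≤ nbhd P1.eta := le_nbhd_eta hxy inf_le_left inf_le_right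
        have e : ∀ z (hz : z ∈ U) (h : nbhd x ⊓ nbhd y ≤ nbhd z),
            F.res h (s z hz) = F.res hW (s P1.eta (eta_mem hx)) := by
          intro z hz h
          rw [← hs z hz, gen, F.res_res]
        exact (e x hx _).trans (e y hy _).symm)
    obtain ⟨r, hr, hr'⟩ := this
    exact ⟨r, fun i _ => hr i, fun r' h' => hr' r' fun i => h' i _⟩
  obtain ⟨r, hr, hr'⟩ := key U hU
  exact ⟨r, fun x hx => hr ⟨x, hx⟩ _, fun r' h' => hr' r' fun i _ => h' i.1 i.2⟩

theorem sec_ext (F : OMod.{u}) {U : Opens P1} {r r' : F.sec U}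
    (h : ∀ x (hx : x ∈ U), F.res (nbhd_le hx) r = F.res (nbhd_le hx) r') : r = r' := by
  refine (F.existsUnique_of_germs U (fun x hx => F.res (nbhd_le hx) r) fun x hx => ?_).unique
    (fun _ _ => rfl) fun x hx => (h x hx).symm
  rw [gen, F.res_res]

/-- Morphisms can be defined on stalks. -/
theorem exists_hom {F : OMod.{u}} {G : OMod.{v}} (f : ∀ x, F.sec (nbhd x) → G.sec (nbhd x))
    (h0 : ∀ x, f x 0 = 0) (hsmul : ∀ x (a : O (nbhd x)) s, f x (a • s) = a • f x s)
    (hgen : ∀ x s, f P1.eta (F.gen s) = G.gen (f x s)) :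
    ∃ φ : Hom F G, ∀ x s, φ.app (nbhd x) s = f x s := by
  have hex := fun (U : Opens P1) (s : F.sec U) =>
    G.existsUnique_of_germs U (fun x hx => f x (F.res (nbhd_le hx) s)) fun x hx => by
      rw [← hgen, gen, F.res_res]
  choose g hg using fun U s => (hex U s).exists
  refine ⟨⟨g, fun U => ?_, fun U a s => ?_, fun {U V} h s => ?_⟩, fun x s => ?_⟩
  · refine G.sec_ext fun x hx => ?_
    rw [hg _ _ _ hx, F.res_zero, G.res_zero, h0]
  · refine G.sec_ext fun x hx => ?_
    rw [hg _ _ _ hx, F.res_smul, G.res_smul, hsmul, hg _ _ _ hx]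
  · refine G.sec_ext fun x hx => ?_
    rw [hg _ _ _ hx, F.res_res, G.res_res, hg _ _ _ (h hx)]
  · have := hg _ s x (mem_nbhd x)
    rwa [F.res_self, G.res_self] at this

theorem Hom.isIso_of_bijective {F : OMod.{u}} {G : OMod.{v}} (f : Hom F G)
    (hf : ∀ x, Function.Bijective (f.app (nbhd x))) : f.IsIso := by
  intro U
  constructor
  · intro s s' h
    refine F.sec_ext fun x hx => (hf x).1 ?_
    rw [f.map_res, f.map_res, h]
  · intro r
    choose s hs using fun x (hx : x ∈ U) => (hf x).2 (G.res (nbhd_le hx) r)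
    obtain ⟨q, hq, -⟩ := F.existsUnique_of_germs U s fun x hx => (hf _).1 (by
      rw [f.map_gen, hs, hs, gen, G.res_res])
    refine ⟨q, G.sec_ext fun x hx => ?_⟩
    rw [← f.map_res, hq _ hx, hs]

theorem isomorphic_of_stalks {F : OMod.{u}} {G : OMod.{v}}
    (f : ∀ x, F.sec (nbhd x) → G.sec (nbhd x))
    (h0 : ∀ x, f x 0 = 0) (hsmul : ∀ x (a : O (nbhd x)) s, f x (a • s) = a • f x s)
    (hgen : ∀ x s, f P1.eta (F.gen s) = G.gen (f x s))
    (hf : ∀ x, Function.Bijective (f x)) : F.Isomorphic G := by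
  obtain ⟨φ, hφ⟩ := exists_hom f h0 hsmul hgen
  exact ⟨φ, φ.isIso_of_bijective fun x => by rw [funext (hφ x)]; exact hf x⟩

/-! ### Coherent normal sheaves -/

/-- Localization identifies two elements only if some nonzero scalar does, and normality cancels
that scalar as long as the product is not the base point. -/
theorem IsCohN.gen_inj {F : OMod.{u}} (hF : F.IsCohN) {x : P1} {s s' : F.sec (nbhd x)}
    (h0 : F.gen s ≠ 0) (h : F.gen s = F.gen s') : s = s' := by
  obtain ⟨a, ha, h'⟩ := hF.1.eq x s s' h
  refine hF.2 x a s s' (fun h1 => ?_) h'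
  have := F.gen_smul a s
  rw [h1, gen_zero] at this
  exact F.smulK_ne_zero (fun h2 => ha (O.val_eq_zero.1 h2)) h0 this.symm

theorem IsCohN.exists_smul_eq_gen {F : OMod.{u}} (hF : F.IsCohN) (x : P1)
    (r : F.sec (nbhd P1.eta)) :
    ∃ (a : O (nbhd x)) (s : F.sec (nbhd x)), a ≠ 0 ∧ value a • r = F.gen s := by
  obtain ⟨a, s, ha, h⟩ := hF.1.surj x r
  rw [smul_eta, O.val_res] at h
  exact ⟨a, s, ha, h⟩

end OMod
/-! ### Decomposition of a sheaf along a labelling of its stalks -/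

namespace OMod

/-- A labelling of the elements of the stalks of `F` which is constant along the action and
restriction as long as the result is not the base point. -/
structure Labelling (F : OMod.{u}) (ι : Type w) where
  lab : ∀ x, F.sec (nbhd x) → ι
  smul : ∀ {x} (a : O (nbhd x)) (s : F.sec (nbhd x)), a • s ≠ 0 → lab x (a • s) = lab x s
  gen : ∀ {x} (s : F.sec (nbhd x)), F.gen s ≠ 0 → lab P1.eta (F.gen s) = lab x s

variable {ι : Type w}

/-- The sections of `F` all of whose nonzero germs have the label `c`. -/
def PartSec (F : OMod.{u}) (L : F.Labelling ι) (c : ι) (U : Opens P1) : Type u :=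
  {s : F.sec U // ∀ x (hx : x ∈ U), F.res (nbhd_le hx) s ≠ 0 →
    L.lab x (F.res (nbhd_le hx) s) = c}

instance (F : OMod.{u}) (L : F.Labelling ι) (c : ι) (U : Opens P1) : Zero (PartSec F L c U) :=
  ⟨⟨0, fun _ _ h => absurd (F.res_zero _) h⟩⟩

instance (F : OMod.{u}) (L : F.Labelling ι) (c : ι) (U : Opens P1) :
    MulActionWithZero (O U) (PartSec F L c U) where
  smul a s := ⟨a • s.1, fun x hx h => by
    rw [F.res_smul] at h ⊢
    rw [L.smul _ _ h]
    exact s.2 x hx fun h' => h (by rw [h', smul_zero])⟩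
  one_smul _ := Subtype.ext (one_smul _ _)
  mul_smul _ _ _ := Subtype.ext (mul_smul _ _ _)
  smul_zero _ := Subtype.ext (smul_zero _)
  zero_smul _ := Subtype.ext (zero_smul _ _)

/-- The subsheaf of sections all of whose nonzero germs have the label `c`. -/
def part (F : OMod.{u}) (L : F.Labelling ι) (c : ι) : OMod.{u} where
  sec U := PartSec F L c U
  res h s := ⟨F.res h s.1, fun x hx => by
    rw [F.res_res]
    exact s.2 x (h hx)⟩
  res_zero h := Subtype.ext (F.res_zero h)
  res_smul h a s := Subtype.ext (F.res_smul h a s.1)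
  res_self s := Subtype.ext (F.res_self s.1)
  res_res h h' s := Subtype.ext (F.res_res h h' s.1)
  glue U s hs := by
    obtain ⟨r, hr, hr'⟩ := F.glue U (fun i => (s i).1) fun i j => congrArg Subtype.val (hs i j)
    refine ⟨⟨r, fun x hx => ?_⟩, fun i => Subtype.ext (hr i), fun r' h' =>
      Subtype.ext (hr' r'.1 fun i => congrArg Subtype.val (h' i))⟩
    obtain ⟨i, hi⟩ := Opens.mem_iSup.1 hx
    have e : F.res (nbhd_le hx) r = F.res (nbhd_le hi) (s i).1 := by
      rw [← F.res_res (le_iSup U i) (nbhd_le hi)]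
      exact congrArg _ (hr i)
    rw [e]
    exact (s i).2 x hi

variable {F : OMod.{u}} {G : OMod.{v}} {L : F.Labelling ι} {M : G.Labelling ι} {c : ι}

theorem Labelling.lab_res (L : F.Labelling ι) {x y : P1} (hy : y ∈ nbhd x) (s : F.sec (nbhd x))
    (h : F.res (nbhd_le hy) s ≠ 0) : s ≠ 0 ∧ L.lab y (F.res (nbhd_le hy) s) = L.lab x s := by
  refine ⟨fun h' => h (by rw [h', F.res_zero]), ?_⟩
  rcases mem_nbhd_iff.1 hy with rfl | rfl
  · rw [F.res_self]
  · exact L.gen s h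

/-- An element of the stalk with label `c`, as an element of the stalk of `part c`. -/
def part.mk (L : F.Labelling ι) (c : ι) {x : P1} (s : F.sec (nbhd x))
    (h : s ≠ 0 → L.lab x s = c) : (F.part L c).sec (nbhd x) :=
  ⟨s, fun _ hy h' => (L.lab_res hy s h').2.trans (h (L.lab_res hy s h').1)⟩

theorem part.lab_eq {x : P1} (s : (F.part L c).sec (nbhd x)) (h : s.1 ≠ 0) : L.lab x s.1 = c := by
  have := s.2 x (mem_nbhd x)
  rw [F.res_self] at this
  exact this h

theorem part.val_eq_zero {U : Opens P1} (s : (F.part L c).sec U) : s.1 = 0 ↔ s = 0 :=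
  ⟨fun h => Subtype.ext h, fun h => congrArg Subtype.val h⟩

theorem part.val_gen {x : P1} (s : (F.part L c).sec (nbhd x)) :
    ((F.part L c).gen s).1 = F.gen s.1 := rfl

theorem part.val_smul {U : Opens P1} (a : O U) (s : (F.part L c).sec U) :
    (a • s).1 = a • s.1 := rfl

theorem part.val_zero {U : Opens P1} : (0 : (F.part L c).sec U).1 = 0 := rfl

/-- Generators and numerators found in `F` serve for the part as well: an element with a nonzero
multiple or restriction of label `c` has label `c` itself. -/
theorem isCohN_part (hF : F.IsCohN) : (F.part L c).IsCohN := by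
  classical
  refine ⟨⟨fun x => ?_, fun x r => ?_, fun x s s' h => ?_⟩, fun x a m m' h0 h => ?_⟩
  · obtain ⟨T, hT⟩ := hF.1.fg x
    have key : ∀ m : (F.part L c).sec (nbhd x), ∃ g : (F.part L c).sec (nbhd x),
        (g.1 ∈ T ∨ g = 0) ∧ ∃ a : O (nbhd x), m = a • g := by
      intro m
      by_cases hm : m = 0
      · exact ⟨0, Or.inr rfl, 0, by rw [hm, smul_zero]⟩
      · obtain ⟨g, hg, a, ha⟩ := hT m.1
        have hm' : m.1 ≠ 0 := fun h => hm ((part.val_eq_zero m).1 h)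
        refine ⟨part.mk L c g fun _ => ?_, Or.inl hg, a, Subtype.ext ha⟩
        rw [← part.lab_eq m hm', ha]
        exact (L.smul a g (ha ▸ hm')).symm
    -- The base point is added as a generator because no element of `T` need have label `c`.
    have hfin : {g : PartSec F L c (nbhd x) | g.1 ∈ T ∨ g = 0}.Finite :=
      Set.Finite.union (s := {g : PartSec F L c (nbhd x) | g.1 ∈ T})
        (T.finite_toSet.preimage Subtype.val_injective.injOn) (Set.finite_singleton 0)
    refine ⟨hfin.toFinset, fun m => ?_⟩
    obtain ⟨g, hg, h⟩ := key m
    exact ⟨g, hfin.mem_toFinset.2 hg, h⟩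
  · by_cases hr : r = 0
    · refine ⟨1, 0, fun h => one_ne_zero (congrArg value h), ?_⟩
      rw [hr, smul_zero, OMod.res_zero]
    · obtain ⟨a, s, ha, h⟩ := hF.1.surj x r.1
      have hr' : r.1 ≠ 0 := fun h => hr ((part.val_eq_zero r).1 h)
      have h1 : O.res (nbhd_eta_le x) a • r.1 ≠ 0 := by
        rw [smul_eta, O.val_res]
        exact F.smulK_ne_zero (fun h => ha (O.val_eq_zero.1 h)) hr'
      refine ⟨a, part.mk L c s fun _ => ?_, ha, Subtype.ext h⟩
      rw [← part.lab_eq r hr', ← L.smul _ _ h1, ← L.gen s (by rw [gen, ← h]; exact h1)]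
      exact congrArg _ h.symm
  · obtain ⟨a, ha, h'⟩ := hF.1.eq x s.1 s'.1 (congrArg Subtype.val h)
    exact ⟨a, ha, Subtype.ext h'⟩
  · exact Subtype.ext (hF.2 x a m.1 m'.1 (fun h' => h0 (Subtype.ext h')) (congrArg Subtype.val h))

/-- The restriction of a morphism to the parts with label `c`. -/
def Hom.part (f : Hom F G) (hf : ∀ x s, f.app (nbhd x) s ≠ 0 → M.lab x (f.app _ s) = L.lab x s)
    (c : ι) : Hom (F.part L c) (G.part M c) where
  app U s := ⟨f.app U s.1, fun x hx h => by
    rw [← f.map_res] at h ⊢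
    rw [hf _ _ h]
    exact s.2 x hx fun h' => h (by rw [h', f.map_zero])⟩
  map_zero U := Subtype.ext (f.map_zero U)
  map_smul U a s := Subtype.ext (f.map_smul U a s.1)
  map_res h s := Subtype.ext (f.map_res h s.1)

open Classical in
/-- The component with label `c` of an element of a stalk. -/
noncomputable def component (L : F.Labelling ι) {x : P1} (s : F.sec (nbhd x)) (c : ι) :
    (F.part L c).sec (nbhd x) :=
  if h : L.lab x s = c then part.mk L c s fun _ => h else 0

theorem component_of_eq {x : P1} {s : F.sec (nbhd x)} (h : L.lab x s = c) :
    (component L s c).1 = s := by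
  rw [component, dif_pos h]; rfl

theorem component_of_ne {x : P1} {s : F.sec (nbhd x)} (h : L.lab x s ≠ c) :
    component L s c = 0 := dif_neg h

theorem component_zero {x : P1} : component L (0 : F.sec (nbhd x)) c = 0 := by
  by_cases h : L.lab x 0 = c
  · exact (part.val_eq_zero _).1 (component_of_eq h)
  · exact component_of_ne h

theorem component_smul {x : P1} (a : O (nbhd x)) (s : F.sec (nbhd x)) :
    component L (a • s) c = a • component L s c := by
  by_cases h0 : a • s = 0
  · rw [h0, component_zero]
    by_cases h : L.lab x s = c
    · refine Subtype.ext ?_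
      rw [part.val_smul, component_of_eq h, h0, part.val_zero]
    · rw [component_of_ne h, smul_zero]
  · have e := L.smul a s h0
    by_cases h : L.lab x s = c
    · refine Subtype.ext ?_
      rw [part.val_smul, component_of_eq h, component_of_eq (e.trans h)]
    · rw [component_of_ne h, smul_zero, component_of_ne (fun h' => h (e.symm.trans h'))]

theorem component_gen {x : P1} (s : F.sec (nbhd x)) :
    component L (F.gen s) c = (F.part L c).gen (component L s c) := by
  by_cases h0 : F.gen s = 0
  · rw [h0, component_zero]
    by_cases h : L.lab x s = c
    · refine Subtype.ext ?_
      rw [part.val_gen, component_of_eq h, h0, part.val_zero]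
    · rw [component_of_ne h, gen_zero]
  · have e := L.gen s h0
    by_cases h : L.lab x s = c
    · refine Subtype.ext ?_
      rw [part.val_gen, component_of_eq h, component_of_eq (e.trans h)]
    · rw [component_of_ne h, gen_zero, component_of_ne (fun h' => h (e.symm.trans h'))]

theorem component_ne_zero {x : P1} {s : F.sec (nbhd x)} (h : component L s c ≠ 0) :
    L.lab x s = c := by
  by_contra h'
  exact h (component_of_ne h')

/-- An element of a stalk as an element of the stalk of the direct sum of the parts. -/
noncomputable def components (L : F.Labelling ι) {x : P1} (s : F.sec (nbhd x)) :
    (directSum fun c => F.part L c).sec (nbhd x) :=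
  ⟨fun c => component L s c, fun y hy i j hi hj => by
    have h : ∀ k, (F.part L k).res (nbhd_le hy) (component L s k) ≠ 0 → L.lab x s = k :=
      fun k hk => component_ne_zero fun h' => hk (by rw [h', OMod.res_zero])
    exact (h i hi).symm.trans (h j hj)⟩

/-- An element sits in the single component given by its label; conversely, at most one coordinate
of a stalk element of the direct sum is nonzero. -/
theorem components_bijective (L : F.Labelling ι) (x : P1) :
    Function.Bijective (components L : F.sec (nbhd x) → _) := by
  constructor
  · have key : ∀ s s' : F.sec (nbhd x), s ≠ 0 → components L s = components L s' → s = s' := by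
      intro s s' hs h
      have h1 := congrArg Subtype.val (congrFun (congrArg Subtype.val h) (L.lab x s))
      change (component L s _).1 = (component L s' _).1 at h1
      rw [component_of_eq rfl] at h1
      rw [h1]
      refine component_of_eq (component_ne_zero fun h' => hs ?_)
      rw [h1, h', part.val_zero]
    intro s s' h
    by_cases hs : s = 0
    · by_cases hs' : s' = 0
      · rw [hs, hs']
      · exact (key s' s hs' h.symm).symm
    · exact key s s' hs h
  · intro f
    have huniq : ∀ i j, f.1 i ≠ 0 → f.1 j ≠ 0 → i = j := by
      intro i j hi hj
      refine f.2 x (mem_nbhd x) i j ?_ ?_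
      · rwa [OMod.res_self]
      · rwa [OMod.res_self]
    by_cases h : ∃ c, f.1 c ≠ 0
    · obtain ⟨c, hc⟩ := h
      have hc' : (f.1 c).1 ≠ 0 := fun h => hc ((part.val_eq_zero _).1 h)
      refine ⟨(f.1 c).1, Subtype.ext (funext fun d => ?_)⟩
      change component L (f.1 c).1 d = f.1 d
      by_cases hd : c = d
      · subst hd
        exact Subtype.ext (component_of_eq (part.lab_eq _ hc'))
      · rw [component_of_ne (by rwa [part.lab_eq _ hc'])]
        by_contra h'
        exact hd (huniq c d hc fun h'' => h' h''.symm)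
    · push Not at h
      refine ⟨0, Subtype.ext (funext fun d => ?_)⟩
      exact component_zero.trans (h d).symm

/-- A sheaf is the direct sum of its parts. -/
theorem exists_hom_directSum_part (L : F.Labelling ι) :
    ∃ φ : Hom F (directSum fun c => F.part L c), φ.IsIso ∧
      ∀ x s, φ.app (nbhd x) s = components L s := by
  obtain ⟨φ, hφ⟩ := exists_hom (F := F) (G := directSum fun c => F.part L c)
    (fun x => components L)
    (fun x => Subtype.ext (funext fun c => component_zero))
    (fun x a s => Subtype.ext (funext fun c => component_smul a s))
    (fun x s => Subtype.ext (funext fun c => component_gen s))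
  exact ⟨φ, φ.isIso_of_bijective fun x => by
    rw [funext (hφ x)]
    exact components_bijective L x, hφ⟩

theorem component_map (f : Hom F G)
    (hf : ∀ x s, f.app (nbhd x) s ≠ 0 → M.lab x (f.app _ s) = L.lab x s) {x : P1}
    (s : F.sec (nbhd x)) :
    component M (f.app _ s) c = (f.part hf c).app _ (component L s c) := by
  by_cases h0 : f.app _ s = 0
  · rw [h0, component_zero]
    by_cases h : L.lab x s = c
    · refine Subtype.ext ?_
      change 0 = f.app _ (component L s c).1
      rw [component_of_eq h, h0]
    · rw [component_of_ne h, Hom.map_zero]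
  · have e := hf x s h0
    by_cases h : L.lab x s = c
    · refine Subtype.ext ?_
      change _ = f.app _ (component L s c).1
      rw [component_of_eq h, component_of_eq (e.trans h)]
    · rw [component_of_ne h, Hom.map_zero, component_of_ne (fun h' => h (e.symm.trans h'))]

theorem sq_of_stalks {A : OMod.{u}} {B : OMod.{v}} {C D : OMod.{w}} (a : Hom A B) (b : Hom B D)
    (c : Hom A C) (d : Hom C D) (h : ∀ x (s : A.sec (nbhd x)),
      b.app _ (a.app _ s) = d.app _ (c.app _ s)) (U : Opens P1) (s : A.sec U) :
    b.app U (a.app U s) = d.app U (c.app U s) := by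
  refine D.sec_ext fun x hx => ?_
  rw [← b.map_res, ← a.map_res, ← d.map_res, ← c.map_res, h]

end OMod

/-! ### Decomposition of a short exact sequence along a labelling of its middle term -/

namespace Seq

variable {ι : Type w} {S : Seq.{u}}

theorem map_ne_zero_of_injective {F : OMod.{u}} {G : OMod.{v}} {f : OMod.Hom F G} {x : P1}
    (hf : Function.Injective (f.app (nbhd x))) {s : F.sec (nbhd x)} (hs : s ≠ 0) :
    f.app _ s ≠ 0 := fun h => hs (hf (h.trans (f.map_zero _).symm))

namespace IsShortExact

/-- The labelling of the subsheaf. -/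
def labF (hS : S.IsShortExact) (L : S.F'.Labelling ι) : S.F.Labelling ι where
  lab x s := L.lab x (S.i.app _ s)
  smul a s h := by
    have := map_ne_zero_of_injective (hS.injective _) h
    rw [S.i.map_smul] at this ⊢
    exact L.smul a _ this
  gen s h := by
    have := map_ne_zero_of_injective (hS.injective _) h
    rw [S.i.map_gen] at this ⊢
    exact L.gen _ this

/-- Normality of `S.p` makes the preimage of a nonzero element unique, so the chosen preimage is the
given one. This is what lets labels pass to the quotient. -/
theorem surjInv_map (hS : S.IsShortExact) {x : P1} {s : S.F'.sec (nbhd x)}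
    (h : S.p.app _ s ≠ 0) : Function.surjInv (hS.surjective x) (S.p.app _ s) = s := by
  have e := Function.surjInv_eq (hS.surjective x) (S.p.app _ s)
  exact hS.normal_p x _ _ (by rwa [e]) e

/-- The labelling of the quotient. -/
noncomputable def labF'' (hS : S.IsShortExact) (L : S.F'.Labelling ι) : S.F''.Labelling ι where
  lab x s := L.lab x (Function.surjInv (hS.surjective x) s)
  smul {x} a s h := by
    obtain ⟨r, rfl⟩ := hS.surjective x s
    have h' : S.p.app _ r ≠ 0 := fun h1 => h (by rw [h1, smul_zero])
    rw [← S.p.map_smul] at h ⊢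
    rw [hS.surjInv_map h', hS.surjInv_map h]
    exact L.smul a r fun h1 => h (by rw [h1, S.p.map_zero])
  gen {x} s h := by
    obtain ⟨r, rfl⟩ := hS.surjective x s
    have h' : S.p.app _ r ≠ 0 := fun h1 => h (by rw [h1, OMod.gen_zero])
    rw [← S.p.map_gen] at h ⊢
    rw [hS.surjInv_map h', hS.surjInv_map h]
    exact L.gen r fun h1 => h (by rw [h1, S.p.map_zero])

theorem labF''_map (hS : S.IsShortExact) (L : S.F'.Labelling ι) (x : P1) (s : S.F'.sec (nbhd x))
    (h : S.p.app _ s ≠ 0) : (hS.labF'' L).lab x (S.p.app _ s) = L.lab x s :=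
  congrArg _ (hS.surjInv_map h)

/-- The subsequence with label `c`. -/
noncomputable def part (hS : S.IsShortExact) (L : S.F'.Labelling ι) (c : ι) : Seq.{u} where
  F := S.F.part (hS.labF L) c
  F' := S.F'.part L c
  F'' := S.F''.part (hS.labF'' L) c
  i := S.i.part (fun _ _ _ => rfl) c
  p := S.p.part (hS.labF''_map L) c

/-- The outer labels are pulled back from the middle term, so preimages under either map keep the
label and exactness restricts to each part. -/
theorem isShortExact_part (hS : S.IsShortExact) (L : S.F'.Labelling ι) (c : ι) :
    (hS.part L c).IsShortExact where
  cohN := OMod.isCohN_part hS.cohN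
  cohN' := OMod.isCohN_part hS.cohN'
  cohN'' := OMod.isCohN_part hS.cohN''
  normal_i x s s' h0 h := Subtype.ext
    (hS.normal_i x s.1 s'.1 (fun h' => h0 (Subtype.ext h')) (congrArg Subtype.val h))
  normal_p x s s' h0 h := Subtype.ext
    (hS.normal_p x s.1 s'.1 (fun h' => h0 (Subtype.ext h')) (congrArg Subtype.val h))
  injective x s s' h := Subtype.ext (hS.injective x (congrArg Subtype.val h))
  exact x s := by
    constructor
    · intro h
      obtain ⟨r, hr⟩ := (hS.exact x s.1).1 (congrArg Subtype.val h)
      refine ⟨OMod.part.mk (hS.labF L) c r fun h0 => ?_, Subtype.ext hr⟩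
      change L.lab x (S.i.app _ r) = c
      have h1 := map_ne_zero_of_injective (hS.injective _) h0
      rw [hr] at h1 ⊢
      exact OMod.part.lab_eq s h1
    · rintro ⟨r, rfl⟩
      exact Subtype.ext ((hS.exact x _).2 ⟨r.1, rfl⟩)
  surjective x s := by
    by_cases h0 : s = 0
    · exact ⟨0, by rw [h0, OMod.Hom.map_zero]⟩
    · obtain ⟨r, hr⟩ := hS.surjective x s.1
      have h1 : s.1 ≠ 0 := fun h => h0 ((OMod.part.val_eq_zero s).1 h)
      refine ⟨OMod.part.mk L c r fun _ => ?_, Subtype.ext hr⟩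
      rw [← OMod.part.lab_eq s h1, ← hr]
      exact (hS.labF''_map L x r (by rwa [hr])).symm

theorem isomorphic_directSum_part (hS : S.IsShortExact) (L : S.F'.Labelling ι) :
    S.Isomorphic (directSum fun c => hS.part L c) := by
  obtain ⟨f, hf, hf1⟩ := OMod.exists_hom_directSum_part (hS.labF L)
  obtain ⟨f', hf', hf1'⟩ := OMod.exists_hom_directSum_part L
  obtain ⟨f'', hf'', hf1''⟩ := OMod.exists_hom_directSum_part (hS.labF'' L)
  refine ⟨f, f', f'', hf, hf', hf'',
    OMod.sq_of_stalks S.i f' f (directSum fun c => hS.part L c).i fun x s => ?_,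
    OMod.sq_of_stalks S.p f'' f' (directSum fun c => hS.part L c).p fun x s => ?_⟩
  · rw [hf1, hf1']
    exact Subtype.ext (funext fun c =>
      OMod.component_map S.i (L := hS.labF L) (M := L) (fun _ _ _ => rfl) _)
  · rw [hf1', hf1'']
    exact Subtype.ext (funext fun c => OMod.component_map S.p (hS.labF''_map L) _)

end IsShortExact

end Seq
/-! ### The connected components of a normal coherent sheaf -/

namespace OMod

/-- The elements of all stalks. -/
abbrev Elt (F : OMod.{u}) : Type u := Σ x, F.sec (nbhd x)

/-- Two elements of the stalks are connected if both are base points, or both are not torsion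
and lie in the same generic orbit, or both are torsion elements of the same stalk and one is a
multiple of the other. -/
inductive Conn (F : OMod.{u}) : Elt F → Elt F → Prop
  | zero (x y : P1) : Conn F ⟨x, 0⟩ ⟨y, 0⟩
  | gen {x y : P1} (s : F.sec (nbhd x)) (s' : F.sec (nbhd y)) (v : K) (h : F.gen s ≠ 0)
      (h' : F.gen s' ≠ 0) (e : v • F.gen s = F.gen s') : Conn F ⟨x, s⟩ ⟨y, s'⟩
  | left {x : P1} (a : O (nbhd x)) (s : F.sec (nbhd x)) (h : F.gen s = 0) (h' : a • s ≠ 0) :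
      Conn F ⟨x, s⟩ ⟨x, a • s⟩
  | right {x : P1} (a : O (nbhd x)) (s : F.sec (nbhd x)) (h : F.gen s = 0) (h' : a • s ≠ 0) :
      Conn F ⟨x, a • s⟩ ⟨x, s⟩

variable {F : OMod.{u}}

theorem Conn.symm {e e' : Elt F} (h : Conn F e e') : Conn F e' e := by
  cases h with
  | zero x y => exact .zero y x
  | gen s s' v h h' e =>
    have hv : v ≠ 0 := by
      rintro rfl
      exact h' (by rw [← e, zero_smul])
    exact .gen s' s v⁻¹ h' h (by rw [← e, inv_smul_smul₀ hv])
  | left a s h h' => exact .right a s h h'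
  | right a s h h' => exact .left a s h h'

/-- Being the base point and being torsion are invariants of connectedness. This lemma and the next
ones use them to recover which kind of connection is present. -/
theorem Conn.ne_zero {e e' : Elt F} (h : Conn F e e') : e.2 ≠ 0 → e'.2 ≠ 0 := by
  cases h with
  | zero x y => exact fun h => absurd rfl h
  | gen s s' v h h' e => exact fun _ h0 => h' (by rw [show s' = 0 from h0, gen_zero])
  | left a s h h' => exact fun _ => h'
  | right a s h h' => exact fun _ h0 => h' (by rw [show s = 0 from h0, smul_zero])

theorem gen_smul_eq_zero {x : P1} {a : O (nbhd x)} {s : F.sec (nbhd x)} (h : a • s ≠ 0) :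
    F.gen (a • s) = 0 ↔ F.gen s = 0 := by
  rw [gen_smul]
  refine ⟨fun h1 => ?_, fun h1 => by rw [h1, smul_zero]⟩
  by_contra h2
  refine F.smulK_ne_zero (fun h3 => h ?_) h2 h1
  rw [O.val_eq_zero.1 h3, zero_smul]

theorem Conn.gen_eq_zero {e e' : Elt F} (h : Conn F e e') : F.gen e.2 = 0 ↔ F.gen e'.2 = 0 := by
  cases h with
  | zero x y => exact iff_of_true (F.gen_zero) (F.gen_zero)
  | gen s s' v h h' e => exact iff_of_false h h'
  | left a s h h' => exact (gen_smul_eq_zero h').symm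
  | right a s h h' => exact gen_smul_eq_zero h'

theorem Conn.exists_smul_gen {e e' : Elt F} (h : Conn F e e') (h0 : F.gen e.2 ≠ 0) :
    ∃ v : K, v • F.gen e.2 = F.gen e'.2 := by
  cases h with
  | zero x y => exact absurd F.gen_zero h0
  | gen s s' v h h' e => exact ⟨v, e⟩
  | left a s h h' => exact absurd h h0
  | right a s h h' => exact absurd ((gen_smul_eq_zero h').2 h) h0

theorem Conn.fst_eq {e e' : Elt F} (h : Conn F e e') (h0 : e.2 ≠ 0) (h1 : F.gen e.2 = 0) :
    e.1 = e'.1 := by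
  cases h with
  | zero x y => exact absurd rfl h0
  | gen s s' v h h' e => exact absurd h1 h
  | left a s h h' => rfl
  | right a s h h' => rfl

theorem Conn.exists_smul {x : P1} {s s' : F.sec (nbhd x)} (h : Conn F ⟨x, s⟩ ⟨x, s'⟩)
    (h1 : F.gen s = 0) : ∃ a : O (nbhd x), s' = a • s ∨ s = a • s' := by
  cases h with
  | zero => exact ⟨0, Or.inl (smul_zero _).symm⟩
  | gen s s' v h h' e => exact absurd h1 h
  | left a s h h' => exact ⟨a, Or.inl rfl⟩
  | right a s h h' => exact ⟨a, Or.inr rfl⟩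

theorem Conn.of_exists_smul {x : P1} {s s' : F.sec (nbhd x)} (h : s ≠ 0) (h' : s' ≠ 0)
    (h1 : F.gen s = 0) (h1' : F.gen s' = 0) (a : O (nbhd x)) (ha : s' = a • s ∨ s = a • s') :
    Conn F ⟨x, s⟩ ⟨x, s'⟩ := by
  rcases ha with rfl | rfl
  · exact .left a s h1 h'
  · exact .right a s' h1' h

/-- Divisibility is total on nonzero sections of the structure sheaf. -/
theorem _root_.FunP1.O.dvd_total {x : P1} (a b : O (nbhd x)) : a ∣ b ∨ b ∣ a := by
  by_cases ha : a = 0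
  · exact Or.inr (ha ▸ dvd_zero b)
  by_cases hx : x = P1.eta
  · subst hx
    refine Or.inl ⟨O.ofK ((value a)⁻¹ * value b), O.val_injective ?_⟩
    exact (mul_inv_cancel_left₀ (fun h => ha (O.val_eq_zero.1 h)) _).symm
  · rcases O.eq_zero_or_eq_pow hx a with rfl | ⟨k, rfl⟩
    · exact absurd rfl ha
    rcases O.eq_zero_or_eq_pow hx b with rfl | ⟨l, rfl⟩
    · exact Or.inl (dvd_zero _)
    · exact (le_total k l).imp (pow_dvd_pow _) (pow_dvd_pow _)

/-- Scalars at each point are totally ordered by divisibility. Two multiples of one element are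
comparable for this reason alone; two divisors of a nonzero element are comparable after cancelling
the smaller scalar by normality. -/
theorem exists_smul_trans (hF : F.IsCohN) {x : P1} {s s' s'' : F.sec (nbhd x)} (h0 : s' ≠ 0)
    {a b : O (nbhd x)} (ha : s' = a • s ∨ s = a • s') (hb : s'' = b • s' ∨ s' = b • s'') :
    ∃ c : O (nbhd x), s'' = c • s ∨ s = c • s'' := by
  rcases ha with ha | ha
  · rcases hb with hb | hb
    · exact ⟨b * a, Or.inl (by rw [mul_smul, ← ha, hb])⟩
    · rcases O.dvd_total a b with ⟨c, hc⟩ | ⟨c, hc⟩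
      · refine ⟨c, Or.inr (hF.2 x a s (c • s'') (ha ▸ h0) ?_)⟩
        rw [← ha, hb, hc, mul_smul]
      · refine ⟨c, Or.inl (hF.2 x b s'' (c • s) (hb ▸ h0) ?_)⟩
        rw [← hb, ha, hc, mul_smul]
  · rcases hb with hb | hb
    · rcases O.dvd_total a b with ⟨c, hc⟩ | ⟨c, hc⟩
      · exact ⟨c, Or.inl (by rw [hb, ha, hc, mul_comm, mul_smul])⟩
      · exact ⟨c, Or.inr (by rw [hb, ha, hc, mul_comm, mul_smul])⟩
    · exact ⟨a * b, Or.inr (by rw [mul_smul, ← hb, ha])⟩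

theorem Conn.trans (hF : F.IsCohN) {e e' e'' : Elt F} (h : Conn F e e') (h' : Conn F e' e'') :
    Conn F e e'' := by
  obtain ⟨x, s⟩ := e
  obtain ⟨y, s'⟩ := e'
  obtain ⟨z, s''⟩ := e''
  by_cases h0 : s' = 0
  · have h1 : s = 0 := by
      by_contra h1
      exact h.ne_zero h1 h0
    have h2 : s'' = 0 := by
      by_contra h2
      exact h'.symm.ne_zero h2 h0
    rw [h1, h2]
    exact .zero x z
  by_cases hg : F.gen s' = 0
  · obtain rfl : y = x := h.symm.fst_eq h0 hg
    obtain rfl : y = z := h'.fst_eq h0 hg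
    obtain ⟨a, ha⟩ := h.exists_smul (h.gen_eq_zero.2 hg)
    obtain ⟨b, hb⟩ := h'.exists_smul hg
    obtain ⟨c, hc⟩ := exists_smul_trans hF h0 ha hb
    exact .of_exists_smul (h.symm.ne_zero h0) (h'.ne_zero h0) (h.gen_eq_zero.2 hg)
      (h'.gen_eq_zero.1 hg) c hc
  · have hs : F.gen s ≠ 0 := fun h1 => hg (h.gen_eq_zero.1 h1)
    obtain ⟨v, hv⟩ := h.exists_smul_gen hs
    obtain ⟨w, hw⟩ := h'.exists_smul_gen hg
    refine .gen s s'' (w * v) hs (fun h1 => hg (h'.gen_eq_zero.2 h1)) ?_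
    exact (mul_smul _ _ _).trans ((congrArg _ hv).trans hw)

theorem Conn.refl (e : Elt F) : Conn F e e := by
  obtain ⟨x, s⟩ := e
  by_cases h0 : s = 0
  · rw [h0]
    exact .zero x x
  by_cases h : F.gen s = 0
  · exact .of_exists_smul h0 h0 h h 1 (Or.inl (one_smul _ s).symm)
  · exact .gen s s 1 h h (one_smul _ _)

theorem Conn.smul {x : P1} (a : O (nbhd x)) (s : F.sec (nbhd x)) (h : a • s ≠ 0) :
    Conn F ⟨x, a • s⟩ ⟨x, s⟩ := by
  by_cases h0 : F.gen s = 0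
  · exact .right a s h0 h
  · exact (Conn.gen s (a • s) (value a) h0 (fun h1 => h0 ((gen_smul_eq_zero h).1 h1))
      (F.gen_smul a s).symm).symm

theorem Conn.res {x : P1} (s : F.sec (nbhd x)) (h : F.gen s ≠ 0) :
    Conn F ⟨P1.eta, F.gen s⟩ ⟨x, s⟩ :=
  .gen (F.gen s) s 1 (by rwa [gen_eta]) h (by rw [gen_eta, one_smul])

/-- Connectedness as an equivalence relation. -/
def IsCohN.setoid (hF : F.IsCohN) : Setoid (Elt F) :=
  ⟨Conn F, Conn.refl, Conn.symm, Conn.trans hF⟩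

/-- Every nonzero element is connected to one of the finitely many generators of the three stalks,
and the base points form one more class. -/
theorem IsCohN.finite_quotient (hF : F.IsCohN) : Finite (Quotient hF.setoid) := by
  choose T hT using hF.1.fg
  have hsurj : Function.Surjective (fun o : Option (Σ x, T x) => match o with
      | none => (Quotient.mk hF.setoid ⟨P1.eta, 0⟩)
      | some g => Quotient.mk hF.setoid ⟨g.1, g.2.1⟩) := by
    intro q
    induction q using Quotient.inductionOn with
    | h e =>
      obtain ⟨x, s⟩ := e
      by_cases h0 : s = 0
      · refine ⟨none, Quotient.sound (s := hF.setoid) ?_⟩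
        rw [h0]
        exact Conn.zero _ _
      · obtain ⟨g, hg, a, rfl⟩ := hT x s
        exact ⟨some ⟨x, g, hg⟩, Quotient.sound (s := hF.setoid) (Conn.smul a g h0).symm⟩
  exact Finite.of_surjective _ hsurj

/-- The labelling of a normal coherent sheaf by its finitely many connected components. -/
theorem IsCohN.exists_labelling (hF : F.IsCohN) : ∃ (r : ℕ) (L : F.Labelling (Fin r)),
    ∀ x y (s : F.sec (nbhd x)) (s' : F.sec (nbhd y)), L.lab x s = L.lab y s' →
      Conn F ⟨x, s⟩ ⟨y, s'⟩ := by
  have := hF.finite_quotient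
  obtain ⟨r, ⟨e⟩⟩ := Finite.exists_equiv_fin (Quotient hF.setoid)
  refine ⟨r, ⟨fun x s => e (Quotient.mk hF.setoid ⟨x, s⟩), fun a s h => ?_, fun s h => ?_⟩,
    fun x y s s' h => ?_⟩
  · exact congrArg e (Quotient.sound (s := hF.setoid) (Conn.smul a s h))
  · exact congrArg e (Quotient.sound (s := hF.setoid) (Conn.res s h))
  · exact Quotient.exact (s := hF.setoid) (e.injective h)

/-- A sheaf is connected if all nonzero elements of its stalks are connected. -/
def IsConn (F : OMod.{u}) : Prop :=
  ∀ x y (s : F.sec (nbhd x)) (s' : F.sec (nbhd y)), s ≠ 0 → s' ≠ 0 → Conn F ⟨x, s⟩ ⟨y, s'⟩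

/-- Connectedness is witnessed by a single scalar, not by a path, and the same scalar works inside
the part. -/
theorem isConn_part {r : ℕ} {L : F.Labelling (Fin r)}
    (hL : ∀ x y (s : F.sec (nbhd x)) (s' : F.sec (nbhd y)), L.lab x s = L.lab y s' →
      Conn F ⟨x, s⟩ ⟨y, s'⟩) (c : Fin r) : (F.part L c).IsConn := by
  intro x y s s' hs hs'
  have hs1 : s.1 ≠ 0 := fun h => hs ((part.val_eq_zero _).1 h)
  have hs1' : s'.1 ≠ 0 := fun h => hs' ((part.val_eq_zero _).1 h)
  have h := hL x y s.1 s'.1 ((part.lab_eq s hs1).trans (part.lab_eq s' hs1').symm)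
  by_cases hg : F.gen s.1 = 0
  · obtain rfl : x = y := h.fst_eq hs1 hg
    obtain ⟨a, ha⟩ := h.exists_smul hg
    refine .of_exists_smul hs hs' (Subtype.ext hg) (Subtype.ext (h.gen_eq_zero.1 hg)) a ?_
    exact ha.imp (fun h => Subtype.ext h) (fun h => Subtype.ext h)
  · obtain ⟨v, hv⟩ := h.exists_smul_gen hg
    refine .gen s s' v (fun h1 => hg (congrArg Subtype.val h1))
      (fun h1 => hg (h.gen_eq_zero.2 (congrArg Subtype.val h1))) (Subtype.ext hv)

end OMod
/-! ### Sheaves with cyclic torsion stalks -/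

theorem ModQuot.mk_eq_mk_iff {A : Type u} {M : Type v} [MonoidWithZero A] [Zero M]
    [MulActionWithZero A M] (N : SubMulAction A M) (h0 : (0 : M) ∈ N) {m m' : M} :
    mk N m = mk N m' ↔ m = m' ∨ (m ∈ N ∧ m' ∈ N) := by
  constructor
  · intro h
    by_cases hm : m ∈ N
    · by_cases hm' : m' ∈ N
      · exact Or.inr ⟨hm, hm'⟩
      · have h1 := congrArg Subtype.val h
        rw [mk_of_mem N hm, mk_val_of_notMem N hm'] at h1
        exact absurd (h1 ▸ h0 : m' ∈ N) hm'
    · by_cases hm' : m' ∈ N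
      · have h1 := congrArg Subtype.val h
        rw [mk_of_mem N hm', mk_val_of_notMem N hm] at h1
        exact absurd (h1.symm ▸ h0 : m ∈ N) hm
      · have h1 := congrArg Subtype.val h
        rw [mk_val_of_notMem N hm, mk_val_of_notMem N hm'] at h1
        exact Or.inl h1
  · rintro (rfl | ⟨h, h'⟩)
    · rfl
    · rw [mk_of_mem N h, mk_of_mem N h']

namespace OMod

/-- The stalk at `x` is isomorphic to the quotient of `⟨unif x⟩` by the ideal generated by the
`k`-th power of `unif x`. -/
def IsCyc (F : OMod.{u}) (x : P1) (k : ℕ) : Prop :=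
  ∃ g : F.sec (nbhd x), (∀ s, ∃ a : O (nbhd x), s = a • g) ∧ ∀ a b : O (nbhd x),
    a • g = b • g ↔ a = b ∨ (O.unif x ^ k ∣ a ∧ O.unif x ^ k ∣ b)

/-- At the generic point the uniformizer is `1`, so there `IsCyc` means that the stalk vanishes,
whatever `k` is. -/
theorem unif_pow_dvd_of_trivial {x : P1} {k : ℕ} (hk : k = 0 ∨ x = P1.eta) (a : O (nbhd x)) :
    O.unif x ^ k ∣ a := by
  rcases hk with rfl | rfl
  · rw [pow_zero]
    exact one_dvd a
  · rw [O.unif_eta, one_pow]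
    exact one_dvd a

theorem isCyc_of_forall_eq_zero {F : OMod.{u}} {x : P1} (h : ∀ s : F.sec (nbhd x), s = 0) {k : ℕ}
    (hk : k = 0 ∨ x = P1.eta) : IsCyc F x k :=
  ⟨0, fun s => ⟨0, by rw [h s, smul_zero]⟩, fun a b => iff_of_true (by rw [smul_zero, smul_zero])
    (Or.inr ⟨unif_pow_dvd_of_trivial hk a, unif_pow_dvd_of_trivial hk b⟩)⟩

theorem IsCyc.eq_zero {F : OMod.{u}} {x : P1} {k : ℕ} (h : IsCyc F x k)
    (hk : k = 0 ∨ x = P1.eta) (s : F.sec (nbhd x)) : s = 0 := by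
  obtain ⟨g, hg, hg'⟩ := h
  obtain ⟨a, rfl⟩ := hg s
  rw [← zero_smul (O (nbhd x)) g]
  exact (hg' a 0).2 (Or.inr ⟨unif_pow_dvd_of_trivial hk a, unif_pow_dvd_of_trivial hk 0⟩)

/-- Send `a • g` to `a • γ`: both generators have the same coincidences among their multiples.
Compatibility with restriction is free because the generic stalks vanish. -/
theorem isomorphic_of_isCyc {F : OMod.{u}} {G : OMod.{v}} (k : P1 → ℕ)
    (hF : ∀ x, IsCyc F x (k x)) (hG : ∀ x, IsCyc G x (k x)) : F.Isomorphic G := by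
  have hG0 := (hG P1.eta).eq_zero (Or.inr rfl)
  choose g hg hg' using hF
  choose γ hγ hγ' using hG
  choose c hc using hg
  have key : ∀ x (a : O (nbhd x)), c x (a • g x) • γ x = a • γ x := fun x a =>
    (hγ' x _ _).2 ((hg' x _ _).1 (hc x _).symm)
  refine isomorphic_of_stalks (fun x s => c x s • γ x) (fun x => ?_) (fun x a s => ?_)
    (fun x s => (hG0 _).trans (hG0 _).symm) (fun x => ⟨fun s s' h => ?_, fun s => ?_⟩)
  · have := key x 0
    rwa [zero_smul, zero_smul] at this
  · have := key x (a * c x s)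
    rw [mul_smul, ← hc x s, mul_smul] at this
    exact this
  · rw [hc x s, hc x s']
    exact (hg' x _ _).2 ((hγ' x _ _).1 h)
  · obtain ⟨a, rfl⟩ := hγ x s
    exact ⟨a • g x, key x a⟩

theorem isCyc_iff_of_bijective {F : OMod.{u}} {G : OMod.{v}} (f : Hom F G) {x : P1}
    (hf : Function.Bijective (f.app (nbhd x))) {k : ℕ} : IsCyc F x k ↔ IsCyc G x k := by
  constructor
  · rintro ⟨g, hg, hg'⟩
    refine ⟨f.app _ g, fun s => ?_, fun a b => ?_⟩
    · obtain ⟨s, rfl⟩ := hf.2 s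
      obtain ⟨a, rfl⟩ := hg s
      exact ⟨a, f.map_smul _ a g⟩
    · rw [← f.map_smul, ← f.map_smul, hf.1.eq_iff, hg']
  · rintro ⟨g, hg, hg'⟩
    obtain ⟨g, rfl⟩ := hf.2 g
    refine ⟨g, fun s => ?_, fun a b => ?_⟩
    · obtain ⟨a, ha⟩ := hg (f.app _ s)
      exact ⟨a, hf.1 (by rw [ha, f.map_smul])⟩
    · rw [← hf.1.eq_iff, f.map_smul, f.map_smul, hg']

theorem torsion_eq_zero {x y : P1} (hx : x ≠ P1.eta) (h : y ≠ x) (n : ℕ)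
    (s : (torsion x n).sec (nbhd y)) : s = 0 := by
  funext hy
  rcases mem_nbhd_iff.1 hy with h' | h'
  · exact absurd h'.symm h
  · exact absurd h' hx

theorem isCyc_torsion (x : P1) (n : ℕ) : IsCyc (torsion x n) x n := by
  have hmem : ∀ a : O (nbhd x), O.germ (mem_nbhd x) a ∈ torsionSub x n ↔ O.unif x ^ n ∣ a := by
    intro a
    constructor
    · rintro ⟨b, hb⟩
      refine ⟨O.ofVal x b.1 b.2, O.val_injective ?_⟩
      exact congrArg Subtype.val hb
    · rintro ⟨b, rfl⟩
      exact ⟨O.germ (mem_nbhd x) b, rfl⟩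
  have hsmul : ∀ a : O (nbhd x), O.germ (mem_nbhd x) a • ModQuot.mk (torsionSub x n) 1 =
      ModQuot.mk (torsionSub x n) (O.germ (mem_nbhd x) a) := by
    intro a
    refine (ModQuot.mk_smul_val_mk _ _ _).trans ?_
    rw [smul_eq_mul, mul_one]
  refine ⟨fun _ => ModQuot.mk _ 1, fun s => ?_, fun a b => ?_⟩
  · refine ⟨O.ofVal x (s (mem_nbhd x)).1.1 (s (mem_nbhd x)).1.2, funext fun h => ?_⟩
    exact ((hsmul (O.ofVal x (s h).1.1 (s h).1.2)).trans (ModQuot.mk_val _ (s h))).symm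
  · rw [← hmem, ← hmem]
    have h1 : (O.germ (mem_nbhd x) a = O.germ (mem_nbhd x) b) ↔ a = b :=
      ⟨fun h => O.val_injective (congrArg Subtype.val h), fun h => by rw [h]⟩
    rw [← h1, ← ModQuot.mk_eq_mk_iff (torsionSub x n) ⟨0, (mul_zero _).symm⟩, ← hsmul, ← hsmul]
    exact ⟨fun h => congrFun h (mem_nbhd x), fun h => funext fun _ => h⟩

theorem isomorphic_torsion {F : OMod.{u}} {x : P1} (hx : x ≠ P1.eta) {n : ℕ} (h : IsCyc F x n)
    (h0 : ∀ y ≠ x, ∀ s : F.sec (nbhd y), s = 0) : F.Isomorphic (torsion x n) := by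
  classical
  refine isomorphic_of_isCyc (Function.update 0 x n) (fun y => ?_) (fun y => ?_)
  · by_cases hy : y = x
    · subst hy
      rwa [Function.update_self]
    · rw [Function.update_of_ne hy]
      exact isCyc_of_forall_eq_zero (h0 y hy) (Or.inl rfl)
  · by_cases hy : y = x
    · subst hy
      rw [Function.update_self]
      exact isCyc_torsion y n
    · rw [Function.update_of_ne hy]
      exact isCyc_of_forall_eq_zero (torsion_eq_zero hx hy n) (Or.inl rfl)

theorem inl_bijective (F G : OMod.{u}) {x : P1} (h : ∀ s : G.sec (nbhd x), s = 0) :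
    Function.Bijective ((inl F G).app (nbhd x)) := by
  constructor
  · intro s s' e
    exact congrFun (congrArg Subtype.val e) false
  · intro s
    refine ⟨s.1 false, Subtype.ext (funext fun b => ?_)⟩
    cases b
    · rfl
    · exact (h (s.1 true)).symm

theorem snd_bijective (F G : OMod.{u}) {x : P1} (h : ∀ s : F.sec (nbhd x), s = 0) :
    Function.Bijective ((snd F G).app (nbhd x)) := by
  constructor
  · intro s s' e
    refine Subtype.ext (funext fun b => ?_)
    cases b
    · exact (h (s.1 false)).trans (h (s'.1 false)).symm
    · exact e
  · intro s
    refine ⟨⟨fun b => match b with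
      | false => (0 : F.sec (nbhd x))
      | true => s, fun y hy i j hi hj => ?_⟩, rfl⟩
    cases i <;> cases j
    · rfl
    · exact absurd (F.res_zero _) hi
    · exact absurd (F.res_zero _) hj
    · rfl

/-- At each point at most one summand is nonzero, so the stalks of the sum are cyclic with the same
exponents as those of `F`. -/
theorem isomorphic_oplus_torsion {F : OMod.{u}} {k₀ k₁ : ℕ} (h0 : IsCyc F P1.zero k₀)
    (h1 : IsCyc F P1.infty k₁) (he : ∀ s : F.sec (nbhd P1.eta), s = 0) :
    F.Isomorphic (oplus (torsion P1.zero k₀) (torsion P1.infty k₁)) := by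
  have e0 : P1.zero ≠ P1.eta := nofun
  have e1 : P1.infty ≠ P1.eta := nofun
  have e2 : P1.infty ≠ P1.zero := nofun
  have hl : ∀ x ≠ P1.infty, ∀ k, IsCyc (torsion P1.zero k₀) x k →
      IsCyc (oplus (torsion P1.zero k₀) (torsion P1.infty k₁)) x k := fun x hx k h =>
    (isCyc_iff_of_bijective _ (inl_bijective _ _ (torsion_eq_zero e1 hx k₁))).1 h
  refine isomorphic_of_isCyc (fun x => match x with
    | .zero => k₀
    | .infty => k₁
    | .eta => 0) (fun x => ?_) (fun x => ?_)
  · cases x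
    exacts [h0, h1, isCyc_of_forall_eq_zero he (Or.inl rfl)]
  · cases x
    · exact hl _ e2.symm _ (isCyc_torsion _ _)
    · exact (isCyc_iff_of_bijective _
        (snd_bijective _ _ (torsion_eq_zero e0 e2 k₀))).2 (isCyc_torsion _ _)
    · exact hl _ e1.symm _ (isCyc_of_forall_eq_zero (torsion_eq_zero e0 e0.symm k₀) (Or.inl rfl))

end OMod

/-! ### Connected short exact sequences -/

namespace Seq.IsShortExact

open OMod

variable {S : Seq.{u}}

theorem p_i (hS : S.IsShortExact) {x : P1} (r : S.F.sec (nbhd x)) :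
    S.p.app _ (S.i.app _ r) = 0 := (hS.exact x _).2 ⟨r, rfl⟩

/-- A normal map with trivial kernel is injective, so `S.p` is an isomorphism on stalks. -/
theorem isSplit_of_left_eq_zero (hS : S.IsShortExact) (h : ∀ x (s : S.F.sec (nbhd x)), s = 0) :
    S.IsSplit := by
  refine ⟨S.F, S.F'', ?_⟩
  have hp : ∀ x, Function.Bijective (S.p.app (nbhd x)) := fun x => ⟨fun s s' e => by
    by_cases h0 : S.p.app _ s = 0
    · obtain ⟨r, rfl⟩ := (hS.exact x s).1 h0
      obtain ⟨r', rfl⟩ := (hS.exact x s').1 (e ▸ h0)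
      rw [h x r, h x r']
    · exact hS.normal_p x s s' h0 e, hS.surjective x⟩
  have hs := fun x => snd_bijective S.F S.F'' (h x)
  -- `q` is `S.p` followed by the inverse of the projection, which is bijective on stalks since
  -- `S.F` vanishes.
  choose q hq using fun x (s : S.F'.sec (nbhd x)) => (hs x).2 (S.p.app _ s)
  obtain ⟨f', hf'⟩ := exists_hom (F := S.F') (G := oplus S.F S.F'') q
    (fun x => (hs x).1 (by rw [hq, S.p.map_zero, Hom.map_zero]))
    (fun x a s => (hs x).1 (by rw [hq, S.p.map_smul, Hom.map_smul, hq]))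
    (fun x s => (hs _).1 (by rw [hq, S.p.map_gen, Hom.map_gen, hq]))
  obtain ⟨f, hf⟩ := exists_hom (F := S.F) (G := S.F) (fun _ => id) (fun _ => rfl)
    (fun _ _ _ => rfl) (fun _ _ => rfl)
  obtain ⟨f'', hf''⟩ := exists_hom (F := S.F'') (G := S.F'') (fun _ => id) (fun _ => rfl)
    (fun _ _ _ => rfl) (fun _ _ => rfl)
  refine ⟨f, f', f'', f.isIso_of_bijective fun x => ?_, f'.isIso_of_bijective fun x => ?_,
    f''.isIso_of_bijective fun x => ?_,
    sq_of_stalks S.i f' f (split S.F S.F'').i fun x s => ?_,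
    sq_of_stalks S.p f'' f' (split S.F S.F'').p fun x s => ?_⟩
  · rw [funext (hf x)]
    exact Function.bijective_id
  · refine (Function.Bijective.of_comp_iff' (hs x) _).1 ?_
    convert hp x using 1
    funext s
    rw [Function.comp_apply, hf', hq]
  · rw [funext (hf'' x)]
    exact Function.bijective_id
  · rw [h x s, S.i.map_zero, f.map_zero, f'.map_zero]
    exact ((inl S.F S.F'').map_zero _).symm
  · rw [hf'', hf']
    exact (hq x s).symm

/-- Here `S.i` is bijective on stalks and the quotient vanishes, so its inverse followed by the
inclusion identifies the middle term with the direct sum. -/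
theorem isSplit_of_i_surjective (hS : S.IsShortExact)
    (h : ∀ x, Function.Surjective (S.i.app (nbhd x))) : S.IsSplit := by
  refine ⟨S.F, S.F'', ?_⟩
  have h0 : ∀ x (s : S.F''.sec (nbhd x)), s = 0 := by
    intro x s
    obtain ⟨s, rfl⟩ := hS.surjective x s
    obtain ⟨s, rfl⟩ := h x s
    exact hS.p_i s
  have hi := fun x => (⟨hS.injective x, h x⟩ : Function.Bijective (S.i.app (nbhd x)))
  choose q hq using h
  have hq' : ∀ x s, q x (S.i.app _ s) = s := fun x s => hS.injective x (hq x _)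
  have hqb : ∀ x, Function.Bijective (q x) := fun x =>
    ⟨fun s s' e => by rw [← hq x s, e, hq], fun s => ⟨_, hq' x s⟩⟩
  obtain ⟨f', hf'⟩ := exists_hom (F := S.F') (G := oplus S.F S.F'')
    (fun x s => (inl S.F S.F'').app _ (q x s))
    (fun x => by rw [show q x 0 = 0 from hS.injective x (by rw [hq, S.i.map_zero]), Hom.map_zero])
    (fun x a s => by
      rw [show q x (a • s) = a • q x s from hS.injective x (by rw [hq, S.i.map_smul, hq]),
        Hom.map_smul])
    (fun x s => by
      rw [show q _ (S.F'.gen s) = S.F.gen (q x s) from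
        hS.injective _ (by rw [hq, S.i.map_gen, hq]), Hom.map_gen])
  obtain ⟨f, hf⟩ := exists_hom (F := S.F) (G := S.F) (fun _ => id) (fun _ => rfl)
    (fun _ _ _ => rfl) (fun _ _ => rfl)
  obtain ⟨f'', hf''⟩ := exists_hom (F := S.F'') (G := S.F'') (fun _ => id) (fun _ => rfl)
    (fun _ _ _ => rfl) (fun _ _ => rfl)
  refine ⟨f, f', f'', f.isIso_of_bijective fun x => ?_, f'.isIso_of_bijective fun x => ?_,
    f''.isIso_of_bijective fun x => ?_,
    sq_of_stalks S.i f' f (split S.F S.F'').i fun x s => ?_,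
    sq_of_stalks S.p f'' f' (split S.F S.F'').p fun x s => ?_⟩
  · rw [funext (hf x)]
    exact Function.bijective_id
  · rw [funext (hf' x)]
    exact (inl_bijective _ _ (h0 x)).comp (hqb x)
  · rw [funext (hf'' x)]
    exact Function.bijective_id
  · rw [hf', hq', hf]
    rfl
  · exact (h0 x _).trans (h0 x _).symm

/-- The image of `g` generates, and outside its kernel `S.p` creates no new coincidences; the
multiples of `g` in the kernel are those counted by `d`. -/
theorem isCyc_quotient (hS : S.IsShortExact) {x : P1} {g : S.F'.sec (nbhd x)}
    (hg : ∀ s, ∃ a : O (nbhd x), s = a • g)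
    (hinj : ∀ a b : O (nbhd x), a • g ≠ 0 → a • g = b • g → a = b) {d : ℕ}
    (hd : ∀ a : O (nbhd x), (∃ r, S.i.app _ r = a • g) ↔ O.unif x ^ d ∣ a) :
    IsCyc S.F'' x d := by
  refine ⟨S.p.app _ g, fun s => ?_, fun a b => ?_⟩
  · obtain ⟨s, rfl⟩ := hS.surjective x s
    obtain ⟨a, rfl⟩ := hg s
    exact ⟨a, S.p.map_smul _ _ _⟩
  · rw [← S.p.map_smul, ← S.p.map_smul, ← hd, ← hd, ← hS.exact, ← hS.exact]
    constructor
    · intro h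
      by_cases h0 : S.p.app _ (a • g) = 0
      · exact Or.inr ⟨h0, h ▸ h0⟩
      · refine Or.inl (hinj a b (fun h1 => h0 (by rw [h1, S.p.map_zero])) ?_)
        exact hS.normal_p x _ _ h0 h
    · rintro (rfl | ⟨h, h'⟩)
      · rfl
      · rw [h, h']

/-- Among finitely many pairwise comparable generators, one has all the others as multiples. -/
theorem _root_.FunP1.OMod.IsCohN.exists_generator {F : OMod.{u}} (hF : F.IsCohN) {x : P1}
    (h : ∀ s s' : F.sec (nbhd x), ∃ a : O (nbhd x), s' = a • s ∨ s = a • s') :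
    ∃ g : F.sec (nbhd x), ∀ s, ∃ a : O (nbhd x), s = a • g := by
  classical
  have key : ∀ T : Finset (F.sec (nbhd x)), ∃ g, ∀ s ∈ T, ∃ a : O (nbhd x), s = a • g := by
    intro T
    induction T using Finset.induction_on with
    | empty => exact ⟨0, fun s hs => absurd hs (Finset.notMem_empty s)⟩
    | insert s T _ ih =>
      obtain ⟨g, hg⟩ := ih
      obtain ⟨a, ha | ha⟩ := h g s
      · refine ⟨g, fun r hr => ?_⟩
        rcases Finset.mem_insert.1 hr with rfl | hr
        exacts [⟨a, ha⟩, hg r hr]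
      · refine ⟨s, fun r hr => ?_⟩
        rcases Finset.mem_insert.1 hr with rfl | hr
        · exact ⟨1, (one_smul _ _).symm⟩
        · obtain ⟨b, rfl⟩ := hg r hr
          exact ⟨b * a, by rw [mul_smul, ← ha]⟩
  obtain ⟨T, hT⟩ := hF.1.fg x
  obtain ⟨g, hg⟩ := key T
  refine ⟨g, fun s => ?_⟩
  obtain ⟨r, hr, a, rfl⟩ := hT s
  obtain ⟨b, rfl⟩ := hg r hr
  exact ⟨a * b, (mul_smul _ _ _).symm⟩

/-- Connected torsion elements share their point and are comparable, so the only nonzero stalk is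
cyclic. With `g` its generator, `n` the least exponent killing `g`, and `d` the least exponent
moving `g` into the subsheaf, the three stalks are chains of lengths `n - d`, `n` and `d`. -/
theorem isTorsionType_or_isSplit (hS : S.IsShortExact) (hc : S.F'.IsConn)
    (he : ∀ r : S.F'.sec (nbhd P1.eta), r = 0) : S.IsTorsionType ∨ S.IsSplit := by
  classical
  by_cases hall : ∀ x (s : S.F'.sec (nbhd x)), s = 0
  · exact Or.inr (hS.isSplit_of_left_eq_zero fun x s =>
      hS.injective x ((hall x _).trans (hall x _).symm))
  push Not at hall
  obtain ⟨x, s₀, hs₀⟩ := hall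
  have hx : x ≠ P1.eta := by
    rintro rfl
    exact hs₀ (he s₀)
  have hF' : ∀ y ≠ x, ∀ s : S.F'.sec (nbhd y), s = 0 := by
    intro y hy s
    by_contra hs
    exact hy ((hc x y s₀ s hs₀ hs).fst_eq hs₀ (he _)).symm
  have hF : ∀ y ≠ x, ∀ s : S.F.sec (nbhd y), s = 0 := fun y hy s =>
    hS.injective y ((hF' y hy _).trans (hF' y hy _).symm)
  have hF'' : ∀ y ≠ x, ∀ s : S.F''.sec (nbhd y), s = 0 := by
    intro y hy s
    obtain ⟨s, rfl⟩ := hS.surjective y s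
    rw [hF' y hy s, S.p.map_zero]
  obtain ⟨g, hg⟩ := hS.cohN'.exists_generator (x := x) fun s s' => by
    by_cases hs : s = 0
    · exact ⟨0, Or.inr (by rw [hs, zero_smul])⟩
    by_cases hs' : s' = 0
    · exact ⟨0, Or.inl (by rw [hs', zero_smul])⟩
    exact (hc x x s s' hs hs').exists_smul (he _)
  -- Every scalar at `x` is zero or a power of the uniformizer, so divisibility criteria need
  -- checking only on exponents.
  have hpow : ∀ {P : O (nbhd x) → Prop} {d : ℕ}, P 0 → (∀ j, P (O.unif x ^ j) ↔ d ≤ j) →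
      ∀ a, P a ↔ O.unif x ^ d ∣ a := by
    intro P d h0 hP a
    rcases O.eq_zero_or_eq_pow hx a with rfl | ⟨j, rfl⟩
    · exact iff_of_true h0 (dvd_zero _)
    · rw [hP, O.unif_pow_dvd_iff hx]
  -- The localization vanishes, so a nonzero scalar identifies `g` with the base point.
  have hN : ∃ N : ℕ, O.unif x ^ N • g = 0 := by
    obtain ⟨a, ha, h⟩ := hS.cohN'.1.eq x g 0 ((he _).trans (he _).symm)
    rcases O.eq_zero_or_eq_pow hx a with rfl | ⟨j, rfl⟩
    · exact absurd rfl ha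
    · exact ⟨j, by rw [h, smul_zero]⟩
  let n := Nat.find hN
  have hn : ∀ a : O (nbhd x), a • g = 0 ↔ O.unif x ^ n ∣ a := by
    refine hpow (zero_smul _ _) fun j => ⟨fun h => Nat.find_min' hN h, fun h => ?_⟩
    rw [← Nat.sub_add_cancel h, pow_add, mul_smul, Nat.find_spec hN, smul_zero]
  have hD : ∃ d : ℕ, ∃ r, S.i.app _ r = O.unif x ^ d • g :=
    ⟨n, 0, by rw [S.i.map_zero, Nat.find_spec hN]⟩
  let d := Nat.find hD
  have hdn : d ≤ n := Nat.find_min' hD ⟨0, by rw [S.i.map_zero, Nat.find_spec hN]⟩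
  obtain ⟨f, hf⟩ : ∃ r, S.i.app _ r = O.unif x ^ d • g := Nat.find_spec hD
  have hd : ∀ a : O (nbhd x), (∃ r, S.i.app _ r = a • g) ↔ O.unif x ^ d ∣ a := by
    refine hpow ⟨0, by rw [S.i.map_zero, zero_smul]⟩
      fun j => ⟨fun h => Nat.find_min' hD h, fun h => ?_⟩
    refine ⟨O.unif x ^ (j - d) • f, ?_⟩
    rw [S.i.map_smul, hf, ← mul_smul, ← pow_add, Nat.sub_add_cancel h]
  -- Cancelling the `i`-th power by normality gives `g` as its own multiple by the `j`-th power,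
  -- hence by the `j * n`-th; for positive `j` this last multiple is zero.
  have hlt : ∀ i j : ℕ, O.unif x ^ i • g ≠ 0 → O.unif x ^ i • g = O.unif x ^ (i + j) • g →
      j = 0 := by
    intro i j h0 h
    rw [pow_add, mul_smul] at h
    have h1 : g = O.unif x ^ j • g := hS.cohN'.2 x _ _ _ h0 h
    have h2 : ∀ m : ℕ, g = O.unif x ^ (j * m) • g := by
      intro m
      induction m with
      | zero => rw [mul_zero, pow_zero, one_smul]
      | succ m ih => rw [Nat.mul_succ, pow_add, mul_smul, ← h1, ← ih]
    by_contra hj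
    refine h0 ?_
    rw [h2 n, (hn _).2 (pow_dvd_pow _ (Nat.le_mul_of_pos_left n (Nat.pos_of_ne_zero hj))),
      smul_zero]
  have hinj : ∀ a b : O (nbhd x), a • g ≠ 0 → a • g = b • g → a = b := by
    intro a b h0 h
    rcases O.eq_zero_or_eq_pow hx a with rfl | ⟨i, rfl⟩
    · exact absurd (zero_smul _ _) h0
    rcases O.eq_zero_or_eq_pow hx b with rfl | ⟨j, rfl⟩
    · exact absurd (h.trans (zero_smul _ _)) h0
    rcases le_total i j with hij | hij
    · obtain ⟨l, rfl⟩ := Nat.exists_eq_add_of_le hij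
      rw [hlt i l h0 h, add_zero]
    · obtain ⟨l, rfl⟩ := Nat.exists_eq_add_of_le hij
      rw [hlt j l (h ▸ h0) h.symm, add_zero]
  have heq : ∀ a b : O (nbhd x),
      a • g = b • g ↔ a = b ∨ (O.unif x ^ n ∣ a ∧ O.unif x ^ n ∣ b) := by
    intro a b
    rw [← hn, ← hn]
    refine ⟨fun h => ?_, ?_⟩
    · by_cases h0 : a • g = 0
      · exact Or.inr ⟨h0, h ▸ h0⟩
      · exact Or.inl (hinj a b h0 h)
    · rintro (rfl | ⟨h, h'⟩)
      · rfl
      · rw [h, h']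
  -- The `d`-th multiple of `g` generates the subsheaf stalk, and this computes its annihilator.
  have hcancel : ∀ a : O (nbhd x), O.unif x ^ n ∣ a * O.unif x ^ d ↔ O.unif x ^ (n - d) ∣ a := by
    refine hpow (by rw [zero_mul]; exact dvd_zero _) fun j => ?_
    rw [← pow_add, O.unif_pow_dvd_iff hx]
    omega
  refine Or.inl ⟨x, hx, n - d, n, Nat.sub_le _ _, isomorphic_torsion hx ?_ hF,
    isomorphic_torsion hx ⟨g, hg, heq⟩ hF', isomorphic_torsion hx ?_ hF''⟩
  · refine ⟨f, fun s => ?_, fun a b => ?_⟩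
    · obtain ⟨a, ha⟩ := hg (S.i.app _ s)
      obtain ⟨b, rfl⟩ := (hd a).1 ⟨s, ha⟩
      refine ⟨b, hS.injective x ?_⟩
      rw [ha, S.i.map_smul, hf, ← mul_smul, mul_comm]
    · rw [← (hS.injective x).eq_iff, S.i.map_smul, S.i.map_smul, hf, ← mul_smul, ← mul_smul, heq,
        hcancel, hcancel]
      refine or_congr_left ⟨fun h => ?_, fun h => by rw [h]⟩
      rw [mul_comm a, mul_comm b] at h
      exact O.mul_left_cancel (O.unif_pow_ne_zero x d) h
  · rw [Nat.sub_sub_self hdn]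
    exact hS.isCyc_quotient hg hinj hd

end Seq.IsShortExact
/-! ### Sheaves with a free generic orbit -/

namespace OMod

theorem gen_ofVal_smul {F : OMod.{u}} {x : P1} (a : K) (ha : a ∈ stalk x) (s : F.sec (nbhd x)) :
    F.gen (O.ofVal x a ha • s) = a • F.gen s := F.gen_smul _ _

/-- The exponents of the elements of a free generic orbit that come from the stalk at a closed point
form a half-line. -/
theorem IsCohN.exists_bound {F : OMod.{u}} (hF : F.IsCohN) {r : F.sec (nbhd P1.eta)}
    (hr : ∀ v w : K, v • r = w • r → v = w) (ho : ∀ q, ∃ v : K, q = v • r) {x : P1}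
    (hx : x ≠ P1.eta) :
    ∃ A : ℤ, ∀ k : ℤ, (∃ s : F.sec (nbhd x), F.gen s = unifK x ^ k • r) ↔ A ≤ k := by
  classical
  have hup : ∀ k l : ℤ, k ≤ l → (∃ s : F.sec (nbhd x), F.gen s = unifK x ^ k • r) →
      ∃ s : F.sec (nbhd x), F.gen s = unifK x ^ l • r := by
    rintro k l hkl ⟨s, hs⟩
    refine ⟨O.ofVal x (unifK x ^ (l - k)) ((unifK_zpow_mem_stalk hx).2 (by omega)) • s, ?_⟩
    rw [gen_ofVal_smul, hs, ← mul_smul, ← zpow_add₀ (unifK_ne_zero x), sub_add_cancel]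
  have hne : ∃ k : ℤ, ∃ s : F.sec (nbhd x), F.gen s = unifK x ^ k • r := by
    obtain ⟨a, s, ha, h⟩ := hF.exists_smul_eq_gen x r
    obtain ⟨k, hk⟩ := exists_unifK_zpow hx (fun h' => ha (O.val_eq_zero.1 h'))
    exact ⟨k, s, by rw [← h, hk]⟩
  -- Acting at `x` only raises exponents, so the exponents of finitely many generators bound all of
  -- them from below.
  have hbd : ∃ b : ℤ, ∀ k : ℤ, (∃ s : F.sec (nbhd x), F.gen s = unifK x ^ k • r) → b ≤ k := by
    obtain ⟨T, hT⟩ := hF.1.fg x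
    -- The exponent of a generator is unique because the orbit is free; `0` is a dummy value for a
    -- generator without exponent.
    have hchoice : ∀ g : F.sec (nbhd x), ∃ l : ℤ, ∀ k, F.gen g = unifK x ^ k • r → k = l := by
      intro g
      by_cases h : ∃ l : ℤ, F.gen g = unifK x ^ l • r
      · obtain ⟨l, hl⟩ := h
        exact ⟨l, fun k hk => unifK_zpow_injective hx (hr _ _ (hk.symm.trans hl))⟩
      · exact ⟨0, fun k hk => absurd ⟨k, hk⟩ h⟩
    choose l hl using hchoice
    obtain ⟨b, hb⟩ := (T.image l).bddBelow
    refine ⟨b, ?_⟩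
    rintro k ⟨s, hs⟩
    obtain ⟨g, hg, a, rfl⟩ := hT s
    obtain ⟨v, hv⟩ := ho (F.gen g)
    rw [gen_smul, hv, ← mul_smul] at hs
    have h1 := hr _ _ hs
    have ha0 : value a ≠ 0 := left_ne_zero_of_mul (h1 ▸ zpow_ne_zero k (unifK_ne_zero x))
    have hv0 : v ≠ 0 := right_ne_zero_of_mul (h1 ▸ zpow_ne_zero k (unifK_ne_zero x))
    obtain ⟨i, hi⟩ := exists_unifK_zpow hx ha0
    obtain ⟨j, rfl⟩ := exists_unifK_zpow hx hv0
    have h0 : 0 ≤ i := (unifK_zpow_mem_stalk hx).1 (hi ▸ O.val_mem a)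
    rw [hi, ← zpow_add₀ (unifK_ne_zero x)] at h1
    have h2 := unifK_zpow_injective hx h1
    have h3 := hl g j hv
    have h4 := hb (Finset.mem_coe.2 (Finset.mem_image_of_mem l hg))
    omega
  obtain ⟨b, hb⟩ := hbd
  obtain ⟨A, hA, hA'⟩ := Int.exists_least_of_bdd ⟨b, hb⟩ hne
  exact ⟨A, fun k => ⟨hA' k, fun h => hup A k h hA⟩⟩

/-- Measured from the base element `t ^ A • r`, the stalk at `0` has exponents of `t` at least `0`.
At `∞` exponents count powers of `t⁻¹`, so the bound `B` says that the power of `t` relative to `r`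
is at most `-B`, that is, at most `-B - A` relative to the new base. -/
theorem isomorphic_lineBundle {F : OMod.{u}} (hF : F.IsCohN)
    (h0 : ∀ x (s : F.sec (nbhd x)), F.gen s = 0 → s = 0) {r : F.sec (nbhd P1.eta)}
    (hr : ∀ v w : K, v • r = w • r → v = w) (ho : ∀ q, ∃ v : K, q = v • r) {A B : ℤ}
    (hA : ∀ k : ℤ, (∃ s : F.sec (nbhd P1.zero), F.gen s = unifK P1.zero ^ k • r) ↔ A ≤ k)
    (hB : ∀ k : ℤ, (∃ s : F.sec (nbhd P1.infty), F.gen s = unifK P1.infty ^ k • r) ↔ B ≤ k) :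
    F.Isomorphic (lineBundle (-B - A)) := by
  have htA : t ^ A ≠ 0 := zpow_ne_zero _ t_ne_zero
  have hr' : ∀ v w : K, (v * t ^ A) • r = (w * t ^ A) • r → v = w := fun v w h =>
    mul_right_cancel₀ htA (hr _ _ h)
  have ho' : ∀ q, ∃ v : K, q = (v * t ^ A) • r := by
    intro q
    obtain ⟨v, rfl⟩ := ho q
    exact ⟨v * (t ^ A)⁻¹, by rw [inv_mul_cancel_right₀ htA]⟩
  have hmem : ∀ x (v : K), v ∈ lineStalk (-B - A) x ↔
      ∃ s : F.sec (nbhd x), F.gen s = (v * t ^ A) • r := by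
    intro x v
    by_cases hv : v = 0
    · subst hv
      refine iff_of_true (zero_mem_lineStalk _ _) ⟨0, ?_⟩
      rw [gen_zero, zero_mul, zero_smul]
    obtain ⟨k, rfl⟩ := exists_t_zpow hv
    rw [← zpow_add₀ t_ne_zero]
    cases x
    · refine Iff.trans ?_ (hA (k + A)).symm
      refine (unifK_zpow_mem_stalk (x := P1.zero) nofun).trans ?_
      omega
    · have e : ∀ l : ℤ, t ^ l = unifK P1.infty ^ (-l) := fun l => by
        change t ^ l = t⁻¹ ^ (-l)
        rw [inv_zpow', neg_neg]
      rw [e (k + A)]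
      refine Iff.trans ?_ (hB _).symm
      have : t ^ k ∈ lineStalk (-B - A) P1.infty ↔
          unifK P1.infty ^ (-B - A - k) ∈ stalk P1.infty := by
        have e1 : unifK P1.infty ^ (-B - A - k) = t ^ (k - (-B - A)) := by
          rw [e, neg_sub]
        rw [e1]
        constructor
        · rintro ⟨b, hb, h⟩
          have : t ^ (k - (-B - A)) = b := by
            rw [zpow_sub₀ t_ne_zero, h, mul_div_cancel_left₀ _ (zpow_ne_zero _ t_ne_zero)]
          rwa [this]
        · intro h
          exact ⟨_, h, by rw [← zpow_add₀ t_ne_zero, add_sub_cancel]⟩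
      rw [this, unifK_zpow_mem_stalk (x := P1.infty) nofun]
      omega
    · exact iff_of_true trivial ⟨_, gen_eta F _⟩
  -- `ψ` is the coordinate on the generic orbit relative to the new base; on each stalk the
  -- isomorphism is this coordinate of the generic restriction.
  choose ψ hψ using ho'
  have hψ' : ∀ v : K, ψ ((v * t ^ A) • r) = v := fun v => hr' _ _ (hψ _).symm
  have hmem' : ∀ x (s : F.sec (nbhd x)), ψ (F.gen s) ∈ lineStalk (-B - A) x := fun x s =>
    (hmem x _).2 ⟨s, hψ _⟩
  refine isomorphic_of_stalks (G := lineBundle (-B - A))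
    (fun x s => ⟨fun _ => ψ (F.gen s), fun y => ?_, fun _ _ => rfl⟩)
    (fun x => Subtype.ext (funext fun _ => ?_)) (fun x a s => Subtype.ext (funext fun y => ?_))
    (fun x s => Subtype.ext (funext fun _ => ?_)) (fun x => ⟨fun s s' h => ?_, fun s => ?_⟩)
  · obtain ⟨y, rfl | rfl⟩ := y
    · exact hmem' _ s
    · trivial
  · change ψ (F.gen 0) = 0
    rw [gen_zero, ← hψ' 0, zero_mul, zero_smul]
  · change ψ (F.gen (a • s)) = a.1 y * ψ (F.gen s)
    rw [show a.1 y = value a from a.2.2 _ _, gen_smul]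
    conv_lhs => rw [hψ (F.gen s), ← mul_smul, ← mul_assoc, hψ']
  · change ψ (F.gen (F.gen s)) = ψ (F.gen s)
    rw [gen_eta]
  · have h1 : ψ (F.gen s) = ψ (F.gen s') := congrFun (congrArg Subtype.val h) ⟨x, mem_nbhd x⟩
    have h2 : F.gen s = F.gen s' := by rw [hψ (F.gen s), h1, ← hψ]
    by_cases hs : F.gen s = 0
    · rw [h0 x s hs, h0 x s' (h2 ▸ hs)]
    · exact hF.gen_inj hs h2
  · obtain ⟨q, hq⟩ := (hmem x _).1 (s.2.1 ⟨x, mem_nbhd x⟩)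
    refine ⟨q, Subtype.ext (funext fun y => ?_)⟩
    change ψ (F.gen q) = s.1 y
    rw [hq, hψ']
    exact s.2.2 _ _

end OMod

/-! ### Connected short exact sequences with nonzero generic stalk -/

namespace Seq.IsShortExact

open OMod

variable {S : Seq.{u}}

/-- If the subsheaf contains a generic element of a connected sheaf without torsion and is not the
whole sheaf, then the generic orbit is free. -/
theorem smul_injective (hS : S.IsShortExact) {r₀ : S.F.sec (nbhd P1.eta)}
    (hr₀ : S.i.app _ r₀ ≠ 0)
    (h0 : ∀ x (s : S.F'.sec (nbhd x)), S.F'.gen s = 0 → s = 0)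
    (ho : ∀ q, ∃ v : K, q = v • S.i.app _ r₀) {x : P1} {s : S.F'.sec (nbhd x)}
    (hs : ¬ ∃ f, S.i.app _ f = s) (v w : K) (h : v • S.i.app _ r₀ = w • S.i.app _ r₀) : v = w := by
  by_contra hvw
  -- At the generic point the subsheaf already contains the whole orbit.
  have hx : x ≠ P1.eta := by
    rintro rfl
    obtain ⟨y, rfl⟩ := ho s
    exact hs ⟨y • r₀, S.i.map_smulK _ _⟩
  set r := S.i.app _ r₀ with hr
  have hne : ∀ v w : K, v ≠ w → v • r = w • r → w ≠ 0 := by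
    rintro v w hvw h rfl
    rw [zero_smul] at h
    exact S.F'.smulK_ne_zero hvw hr₀ h
  have hw := hne v w hvw h
  have hv := hne w v (Ne.symm hvw) h.symm
  -- A coincidence of two multiples puts a nontrivial power of the uniformizer in the stabilizer of
  -- `r`; invert it if its exponent is negative.
  have hd : ∃ d : ℤ, 0 < d ∧ unifK x ^ d • r = r := by
    obtain ⟨d, hd⟩ := exists_unifK_zpow hx (mul_ne_zero (inv_ne_zero hw) hv)
    have h1 : unifK x ^ d • r = r := by rw [← hd, mul_smul, h, inv_smul_smul₀ hw]
    have h2 : d ≠ 0 := by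
      rintro rfl
      rw [zpow_zero, inv_mul_eq_one₀ hw] at hd
      exact hvw hd.symm
    rcases lt_or_gt_of_ne h2 with h3 | h3
    · refine ⟨-d, by omega, ?_⟩
      conv_lhs => rw [← h1]
      rw [zpow_neg, inv_smul_smul₀ (zpow_ne_zero _ (unifK_ne_zero x))]
    · exact ⟨d, h3, h1⟩
  obtain ⟨d, hd0, hd⟩ := hd
  have hdn : ∀ n : ℕ, unifK x ^ (d * n) • r = r := by
    intro n
    induction n with
    | zero => rw [Nat.cast_zero, mul_zero, zpow_zero, one_smul]
    | succ n ih =>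
      rw [Nat.cast_succ, mul_add, mul_one, zpow_add₀ (unifK_ne_zero x), mul_smul, hd, ih]
  have hs0 : S.F'.gen s ≠ 0 := fun h => hs ⟨0, by rw [h0 x s h, S.i.map_zero]⟩
  obtain ⟨y, hy⟩ := ho (S.F'.gen s)
  have hy0 : y ≠ 0 := by
    rintro rfl
    exact hs0 (by rw [hy, zero_smul])
  obtain ⟨k, rfl⟩ := exists_unifK_zpow hx hy0
  obtain ⟨a, f, ha, hf⟩ := hS.cohN.exists_smul_eq_gen x r₀
  obtain ⟨j, hj⟩ := exists_unifK_zpow hx (fun h' => ha (O.val_eq_zero.1 h'))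
  -- The exponent `k` of `s` may be raised by multiples of `d` without changing the element. Raising
  -- it `|j - k|` times brings it to at least `j`, the exponent of an element `f` of the subsheaf,
  -- so `s` is a multiple of the image of `f`.
  have hpos : 0 ≤ k + d * ((j - k).natAbs : ℕ) - j := by
    have h1 : ((j - k).natAbs : ℤ) ≤ d * ((j - k).natAbs : ℕ) :=
      le_mul_of_one_le_left (Int.natCast_nonneg _) hd0
    omega
  refine hs ⟨O.ofVal x _ ((unifK_zpow_mem_stalk hx).2 hpos) • f, hS.cohN'.gen_inj ?_ ?_⟩ <;>
    rw [← S.i.map_gen, gen_ofVal_smul, ← hf, ← mul_smul, hj, ← zpow_add₀ (unifK_ne_zero x),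
      sub_add_cancel, S.i.map_smulK, ← hr, zpow_add₀ (unifK_ne_zero x), mul_smul, hdn, ← hy]
  exact hs0

/-- A nonzero generic element excludes torsion by connectedness, so stalks embed in the single
generic orbit. Sheaves with a non-free orbit occur only in the split cases, where the subsheaf is
zero or everything. -/
theorem isLineType_or_isSplit (hS : S.IsShortExact) (hc : S.F'.IsConn)
    {r₁ : S.F'.sec (nbhd P1.eta)} (hr₁ : r₁ ≠ 0) : S.IsLineType ∨ S.IsSplit := by
  have h0 : ∀ x (s : S.F'.sec (nbhd x)), S.F'.gen s = 0 → s = 0 := by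
    intro x s hg
    by_contra hs
    have := (hc x _ s r₁ hs hr₁).gen_eq_zero.1 hg
    exact hr₁ (by rwa [gen_eta] at this)
  have h0F : ∀ x (s : S.F.sec (nbhd x)), S.F.gen s = 0 → s = 0 := by
    intro x s hg
    refine hS.injective x ?_
    rw [S.i.map_zero]
    exact h0 x _ (by rw [← S.i.map_gen, hg, S.i.map_zero])
  by_cases hF : ∀ r : S.F.sec (nbhd P1.eta), r = 0
  · exact Or.inr (hS.isSplit_of_left_eq_zero fun x s => h0F x s (hF _))
  push Not at hF
  obtain ⟨r₀, hr₀⟩ := hF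
  have hr : S.i.app _ r₀ ≠ 0 := map_ne_zero_of_injective (hS.injective _) hr₀
  have ho : ∀ q, ∃ v : K, q = v • S.i.app _ r₀ := by
    intro q
    by_cases hq : q = 0
    · exact ⟨0, by rw [hq, zero_smul]⟩
    · obtain ⟨v, hv⟩ := (hc _ _ _ q hr hq).exists_smul_gen (by rwa [gen_eta])
      rw [gen_eta, gen_eta] at hv
      exact ⟨v, hv.symm⟩
  by_cases hsurj : ∀ x, Function.Surjective (S.i.app (nbhd x))
  · exact Or.inr (hS.isSplit_of_i_surjective hsurj)
  have hns : ∃ x, ∃ s : S.F'.sec (nbhd x), ¬ ∃ f, S.i.app _ f = s := by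
    simpa only [Function.Surjective, not_forall] using hsurj
  obtain ⟨x₁, s₁, hs₁⟩ := hns
  have hfree := hS.smul_injective hr h0 ho hs₁
  have hfreeF : ∀ v w : K, v • r₀ = w • r₀ → v = w := fun v w h =>
    hfree v w (by rw [← S.i.map_smulK, h, S.i.map_smulK])
  have hoF : ∀ q, ∃ v : K, q = v • r₀ := by
    intro q
    obtain ⟨v, hv⟩ := ho (S.i.app _ q)
    exact ⟨v, hS.injective _ (by rw [hv, S.i.map_smulK])⟩
  have hinj : ∀ {x} {s s' : S.F'.sec (nbhd x)}, S.F'.gen s = S.F'.gen s' → s = s' := by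
    intro x s s' h
    by_cases hs : S.F'.gen s = 0
    · rw [h0 x s hs, h0 x s' (h ▸ hs)]
    · exact hS.cohN'.gen_inj hs h
  -- At `x` the middle term has exponents from `A` on and the subsheaf those from `B` on, relative
  -- to the same `r₀`; the quotient keeps the `B - A` exponents in between.
  have hb : ∀ x ≠ P1.eta, ∃ A B : ℤ, A ≤ B ∧
      (∀ k : ℤ, (∃ s : S.F'.sec (nbhd x), S.F'.gen s = unifK x ^ k • S.i.app _ r₀) ↔ A ≤ k) ∧
      (∀ k : ℤ, (∃ s : S.F.sec (nbhd x), S.F.gen s = unifK x ^ k • r₀) ↔ B ≤ k) ∧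
      IsCyc S.F'' x (B - A).toNat := by
    intro x hx
    obtain ⟨A, hA⟩ := hS.cohN'.exists_bound hfree ho hx
    obtain ⟨B, hB⟩ := hS.cohN.exists_bound hfreeF hoF hx
    have hAB : A ≤ B := by
      obtain ⟨f, hf⟩ := (hB B).2 le_rfl
      exact (hA B).1 ⟨S.i.app _ f, by rw [← S.i.map_gen, hf, S.i.map_smulK]⟩
    obtain ⟨g, hg⟩ := (hA A).2 le_rfl
    refine ⟨A, B, hAB, hA, hB, hS.isCyc_quotient (g := g) (fun s => ?_) (fun a b _ h => ?_)
      (fun a => ?_)⟩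
    · obtain ⟨v, hv⟩ := ho (S.F'.gen s)
      by_cases hv0 : v = 0
      · exact ⟨0, by rw [zero_smul]; exact h0 x s (by rw [hv, hv0, zero_smul])⟩
      obtain ⟨k, rfl⟩ := exists_unifK_zpow hx hv0
      have hk := (hA k).1 ⟨s, hv⟩
      refine ⟨O.ofVal x (unifK x ^ (k - A)) ((unifK_zpow_mem_stalk hx).2 (by omega)), hinj ?_⟩
      rw [gen_ofVal_smul, hg, ← mul_smul, ← zpow_add₀ (unifK_ne_zero x), sub_add_cancel, hv]
    · have h1 := congrArg S.F'.gen h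
      rw [gen_smul, gen_smul, hg, ← mul_smul, ← mul_smul] at h1
      exact O.val_injective
        (mul_right_cancel₀ (zpow_ne_zero _ (unifK_ne_zero x)) (hfree _ _ h1))
    · rcases O.eq_zero_or_eq_pow hx a with rfl | ⟨j, rfl⟩
      · exact iff_of_true ⟨0, by rw [S.i.map_zero, zero_smul]⟩ (dvd_zero _)
      · have e : S.F'.gen (O.unif x ^ j • g) = unifK x ^ ((j : ℤ) + A) • S.i.app _ r₀ := by
          rw [gen_smul, hg, ← mul_smul, O.val_pow, O.val_unif, zpow_add₀ (unifK_ne_zero x),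
            zpow_natCast]
        have e1 : (∃ f, S.i.app _ f = O.unif x ^ j • g) ↔ B ≤ (j : ℤ) + A := by
          rw [← hB]
          refine exists_congr fun f => ⟨fun h => ?_, fun h => hinj ?_⟩
          · refine hS.injective _ ?_
            rw [S.i.map_gen, h, e, S.i.map_smulK]
          · rw [← S.i.map_gen, h, S.i.map_smulK, e]
        rw [e1, O.unif_pow_dvd_iff hx]
        omega
  obtain ⟨A₀, B₀, h₀, hA₀, hB₀, hc₀⟩ := hb P1.zero nofun
  obtain ⟨A₁, B₁, h₁, hA₁, hB₁, hc₁⟩ := hb P1.infty nofun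
  -- The difference of the two degrees is the sum of the lengths `B₀ - A₀` and `B₁ - A₁` of the two
  -- gaps.
  refine Or.inl ⟨-B₁ - B₀, -A₁ - A₀, (B₀ - A₀).toNat, (B₁ - A₁).toNat, by omega,
    isomorphic_lineBundle hS.cohN h0F hfreeF hoF hB₀ hB₁,
    isomorphic_lineBundle hS.cohN' h0 hfree ho hA₀ hA₁,
    isomorphic_oplus_torsion hc₀ hc₁ fun q => ?_⟩
  obtain ⟨q, rfl⟩ := hS.surjective _ q
  obtain ⟨v, rfl⟩ := ho q
  rw [← S.i.map_smulK, hS.p_i]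

end Seq.IsShortExact
end FunP1

/-! ### The decomposition theorem -/

theorem mainTheorem3 (S : FunP1.Seq.{u}) (hS : S.IsShortExact) :
    ∃ (r : ℕ) (P : Fin r → FunP1.Seq.{u}),
      (∀ k, (P k).IsShortExact ∧
        ((P k).IsTorsionType ∨ (P k).IsLineType ∨ (P k).IsSplit)) ∧
      S.Isomorphic (FunP1.Seq.directSum P) := by
  obtain ⟨r, L, hL⟩ := hS.cohN'.exists_labelling
  refine ⟨r, hS.part L, fun c => ⟨hS.isShortExact_part L c, ?_⟩, hS.isomorphic_directSum_part L⟩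
  have hc : (hS.part L c).F'.IsConn := FunP1.OMod.isConn_part hL c
  by_cases he : ∀ q : (hS.part L c).F'.sec (FunP1.nbhd FunP1.P1.eta), q = 0
  · exact ((hS.isShortExact_part L c).isTorsionType_or_isSplit hc he).imp_right Or.inr
  · push Not at he
    obtain ⟨q, hq⟩ := he
    exact Or.inr ((hS.isShortExact_part L c).isLineType_or_isSplit hc hq)
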